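/- Consider a double auction with $n$ buyers and $m$ sellers of identical items. Each seller owns one item and has a value $v_s\ge 0$ for keeping it; each buyer has a value $v_b\ge 0$ for receiving at least one item; any set of buyers may trade. All values are drawn independently, from arbitrary distributions $F_b$, $F_s$ on $[0,\infty)$. The social welfare of an allocation is the sum of the values of the buyers who receive an item and of the sellers who keep theirs; $\mathsf{OPT}$ is an allocation of maximum welfare. A mechanism maps bids, randomly, to allocations and payments; it is single-sample if its only information on the distributions is one independent sample $v'_b\sim F_b$, $v'_s\sim F_s$ per agent. Let $k=\min\{n,m\}$ and $j=\max\{1,\,k-\lfloor 2\sqrt k\rfloor\}$. The mechanism *Reserve Rehearsal* is the following. Let $P$ be the multiset consisting of the $j$ largest buyer samples and $k-j$ further copies of the $j$-th largest one (if $k=0$, nothing is done). Comparisons among buyer bids and buyer samples are made with ties broken by a uniformly random ranking of all these $2n$ numbers. The buyers are processed in an arbitrary fixed order, the sellers arrive in uniformly random order. When buyer $b$ with bid $\beta_b$ is processed, let $p_{\min}$ be the current minimum of $P$ ($+\infty$ if $P$ is empty). If $\beta_b>p_{\min}$, then the highest element of $P$ below $\beta_b$ is removed from $P$, the next seller $s$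 is approached, and $b$ and $s$ are offered to trade at price $\max\{v'_s,p_{\min}\}$; they trade, $b$ paying this price to $s$, if and only if the price is at most $b$'s bid and at least $s$'s bid. **Theorem.** Reserve Rehearsal is a single-sample mechanism that * is individually rational (truthful buyers have expected utility $\ge 0$, truthful sellers $\ge v_s$) and strongly budget balanced (the buyers' payments and the sellers' receipts have equal expected sums), both in fact for every realization of the mechanism's randomness, and sellers who keep their item receive no payment; * is dominant-strategy incentive compatible, for every realization of the samples: whatever the others bid, no agent can increase her expected quasi-linear utility by misreporting; * processes the buyers online in fixed order and the sellers online in random order: an item can be sold only to the buyer during whose processing its seller is approached, and all decisions and payments made up to any time depend only on the samples, the private coins, and the identities and bids of the agents approached so far; * is $\left(1+\frac{1}{2-\sqrt 3}\left(1+O\!\left(\frac1{\sqrt k}\right)\right)\right)$-approximate: there is an absolute constant $C\ge 0$ such that for all $n,m\ge 1$, all orders of the buyers and all distributions $F_b,F_s$, $$\mathbb E[\mathsf{SW}(\mathsf{OPT})]\ \le\ \left(1+\frac{1}{2-\sqrt 3}\left(1+\frac{C}{\sqrt k}\right)\right)\cdot\mathbb E[\mathsf{SW}(\text{Reserve Rehearsal})].$$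 -/

import Mathlib

open MeasureTheory
open scoped NNReal ENNReal BigOperators

noncomputable section

/-- One number for each of the `n` buyers and each of the `m` sellers. Buyers are unit demand,
sellers are unit supply and items are identical, so a valuation is a single non-negative number:
a buyer's value for receiving at least one item, a seller's value for keeping her item.
Valuation profiles, bid profiles and sample profiles are all of this type. -/
abbrev Profile (n m : ℕ) : Type := (Fin n → ℝ≥0) × (Fin m → ℝ≥0)

/-- An allocation assigns each seller's item to a buyer, or to nobody (`none`: the seller keeps
it). Buyer `b` receives the set of all items `s` with `a s = some b`. -/
abbrev Allocation (n m : ℕ) : Type := Fin m → Option (Fin n)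

/-- Buyer `b` receives at least one item. -/
def Allocation.Wins {n m : ℕ} (a : Allocation n m) (b : Fin n) : Prop := ∃ s, a s = some b

open Classical in
/-- Social welfare: values of the buyers who receive an item, plus values of the sellers who
keep theirs. -/
def socialWelfare {n m : ℕ} (v : Profile n m) (a : Allocation n m) : ℝ≥0 :=
  (∑ b, if a.Wins b then v.1 b else 0) + ∑ s, if a s = none then v.2 s else 0

/-- The optimal social welfare over all allocations (there are no further constraints). -/
def optWelfare {n m : ℕ} (v : Profile n m) : ℝ≥0 :=
  Finset.univ.sup (socialWelfare v : Allocation n m → ℝ≥0)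

/-- Allocation and payments; `payB b` is paid by buyer `b` to the mechanism, `payS s` is paid by
the mechanism to seller `s`. -/
structure Outcome (n m : ℕ) where
  alloc : Allocation n m
  payB : Fin n → ℝ
  payS : Fin m → ℝ

/-- A randomized direct revelation mechanism whose only information on the value distributions is
one sample profile. The outcome depends on the samples, the bids, the order `σ` of the buyers
(the `t`-th buyer to arrive is `σ t`), the order `π` of the sellers and the private coins. The
private coins are uniform on a finite set, and `π` is uniform and independent of them. -/
structure SingleSampleMechanism (n m : ℕ) where
  Coin : Type
  [fintypeCoin : Fintype Coin]
  [nonemptyCoin : Nonempty Coin]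
  outcome : (samples bids : Profile n m) → (σ : Equiv.Perm (Fin n)) → Coin →
    (π : Equiv.Perm (Fin m)) → Outcome n m

attribute [instance] SingleSampleMechanism.fintypeCoin SingleSampleMechanism.nonemptyCoin

namespace Outcome

variable {n m : ℕ}

open Classical in
/-- Realized quasi-linear utility of buyer `b` with value `v`. -/
def buyerUtility (o : Outcome n m) (b : Fin n) (v : ℝ≥0) : ℝ :=
  (if o.alloc.Wins b then (v : ℝ) else 0) - o.payB b

/-- Realized utility of seller `s` with value `v`. -/
def sellerUtility (o : Outcome n m) (s : Fin m) (v : ℝ≥0) : ℝ :=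
  if o.alloc s = none then (v : ℝ) else o.payS s

end Outcome

namespace SingleSampleMechanism

variable {n m : ℕ} (M : SingleSampleMechanism n m)

/-- Utility of buyer `b` with value `v`, in expectation over the randomness of the mechanism. -/
def buyerUtility (smp bids : Profile n m) (σ : Equiv.Perm (Fin n)) (b : Fin n) (v : ℝ≥0) : ℝ :=
  Finset.univ.expect fun x : M.Coin × Equiv.Perm (Fin m) =>
    (M.outcome smp bids σ x.1 x.2).buyerUtility b v

/-- Utility of seller `s` with value `v`, in expectation over the randomness of the mechanism. -/
def sellerUtility (smp bids : Profile n m) (σ : Equiv.Perm (Fin n)) (s : Fin m) (v : ℝ≥0) : ℝ :=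
  Finset.univ.expect fun x : M.Coin × Equiv.Perm (Fin m) =>
    (M.outcome smp bids σ x.1 x.2).sellerUtility s v

/-- Sellers who keep their item receive no payment. -/
def KeepersUnpaid : Prop :=
  ∀ smp bids σ c π s, (M.outcome smp bids σ c π).alloc s = none →
    (M.outcome smp bids σ c π).payS s = 0

/-- Individual rationality. -/
def IsIR : Prop :=
  ∀ (smp v : Profile n m) (σ : Equiv.Perm (Fin n)),
    (∀ b, 0 ≤ M.buyerUtility smp v σ b (v.1 b)) ∧
    (∀ s, (v.2 s : ℝ) ≤ M.sellerUtility smp v σ s (v.2 s))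

/-- Individual rationality for every realization of the randomness of the mechanism. -/
def IsExPostIR : Prop :=
  ∀ (smp v : Profile n m) (σ : Equiv.Perm (Fin n)) (c : M.Coin) (π : Equiv.Perm (Fin m)),
    (∀ b, 0 ≤ (M.outcome smp v σ c π).buyerUtility b (v.1 b)) ∧
    (∀ s, (v.2 s : ℝ) ≤ (M.outcome smp v σ c π).sellerUtility s (v.2 s))

/-- Dominant-strategy incentive compatibility, for every realization of the samples. -/
def IsDSIC : Prop :=
  ∀ (smp bids : Profile n m) (σ : Equiv.Perm (Fin n)),
    (∀ (b : Fin n) (v : ℝ≥0),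
      M.buyerUtility smp bids σ b v ≤
        M.buyerUtility smp (Function.update bids.1 b v, bids.2) σ b v) ∧
    (∀ (s : Fin m) (v : ℝ≥0),
      M.sellerUtility smp bids σ s v ≤
        M.sellerUtility smp (bids.1, Function.update bids.2 s v) σ s v)

/-- Strong budget balance. -/
def IsSBB : Prop :=
  ∀ (smp v : Profile n m) (σ : Equiv.Perm (Fin n)),
    (Finset.univ.expect fun x : M.Coin × Equiv.Perm (Fin m) =>
      (∑ b, (M.outcome smp v σ x.1 x.2).payB b) - ∑ s, (M.outcome smp v σ x.1 x.2).payS s) = 0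

/-- Strong budget balance for every realization of the randomness of the mechanism. -/
def IsExPostSBB : Prop :=
  ∀ (smp v : Profile n m) (σ : Equiv.Perm (Fin n)) (c : M.Coin) (π : Equiv.Perm (Fin m)),
    (∑ b, (M.outcome smp v σ c π).payB b) - ∑ s, (M.outcome smp v σ c π).payS s = 0

/-- The mechanism approaches the buyers online in the order `σ` and the sellers online in the
order `π`, which is uniformly random. Here `called t` is the number of sellers that have been
approached when the first `t` buyers have been processed: an item can only be sold to the buyer
during whose processing its seller is approached, and all decisions up to that moment (which
sellers are approached, who trades with whom, all payments of the agents approached so far) depend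
only on the agents approached so far and their bids. -/
def IsOnline : Prop :=
  ∃ called : (smp bids : Profile n m) → Equiv.Perm (Fin n) → M.Coin → Equiv.Perm (Fin m) →
      ℕ → ℕ,
    ∀ (smp bids : Profile n m) (σ : Equiv.Perm (Fin n)) (c : M.Coin) (π : Equiv.Perm (Fin m)),
      Monotone (called smp bids σ c π) ∧
      (∀ t, called smp bids σ c π t ≤ m) ∧
      (∀ (i : Fin m) (j : Fin n), (M.outcome smp bids σ c π).alloc (π i) = some (σ j) →
        called smp bids σ c π j ≤ i ∧ (i : ℕ) < called smp bids σ c π (j + 1)) ∧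
      ∀ (t : ℕ) (bids' : Profile n m) (σ' : Equiv.Perm (Fin n)) (π' : Equiv.Perm (Fin m)),
        (∀ j : Fin n, (j : ℕ) < t → σ' j = σ j ∧ bids'.1 (σ j) = bids.1 (σ j)) →
        (∀ i : Fin m, (i : ℕ) < called smp bids σ c π t →
          π' i = π i ∧ bids'.2 (π i) = bids.2 (π i)) →
        called smp bids' σ' c π' t = called smp bids σ c π t ∧
        (∀ j : Fin n, (j : ℕ) < t →
          (M.outcome smp bids' σ' c π').payB (σ j) = (M.outcome smp bids σ c π).payB (σ j)) ∧
        (∀ i : Fin m, (i : ℕ) < called smp bids σ c π t →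
          (M.outcome smp bids' σ' c π').alloc (π i) = (M.outcome smp bids σ c π).alloc (π i) ∧
          (M.outcome smp bids' σ' c π').payS (π i) = (M.outcome smp bids σ c π).payS (π i))

end SingleSampleMechanism

/-- The joint law of independent valuations, buyer `b` with law `FB b`, seller `s` with law
`FS s`. -/
def marketLaw {n m : ℕ} (FB : Fin n → Measure ℝ≥0) (FS : Fin m → Measure ℝ≥0) :
    Measure (Profile n m) :=
  (Measure.pi FB).prod (Measure.pi FS)

/-- Expected optimal social welfare (possibly infinite). -/
def expectedOpt {n m : ℕ} (FB : Fin n → Measure ℝ≥0) (FS : Fin m → Measure ℝ≥0) : ℝ≥0∞ :=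
  ∫⁻ v, (optWelfare v : ℝ≥0∞) ∂(marketLaw FB FS)

/-- Expected social welfare of the mechanism under truthful bids `z.1`, with an independent sample
profile `z.2` from the same distributions; the inner expectation is over the randomness of the
mechanism. -/
def SingleSampleMechanism.expectedWelfare {n m : ℕ} (M : SingleSampleMechanism n m)
    (σ : Equiv.Perm (Fin n)) (FB : Fin n → Measure ℝ≥0) (FS : Fin m → Measure ℝ≥0) : ℝ≥0∞ :=
  ∫⁻ z : Profile n m × Profile n m,
    ((Finset.univ.expect fun x : M.Coin × Equiv.Perm (Fin m) =>
      socialWelfare z.1 (M.outcome z.2 z.1 σ x.1 x.2).alloc : ℝ≥0) : ℝ≥0∞)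
    ∂((marketLaw FB FS).prod (marketLaw FB FS))

/-- `M` is an `α`-approximation to the optimal social welfare, for every choice of the
distributions of the agents and every fixed order of the buyers. -/
def SingleSampleMechanism.IsApprox {n m : ℕ} (M : SingleSampleMechanism n m) (α : ℝ) : Prop :=
  ∀ (σ : Equiv.Perm (Fin n)) (FB : Fin n → Measure ℝ≥0) (FS : Fin m → Measure ℝ≥0),
    (∀ b, IsProbabilityMeasure (FB b)) → (∀ s, IsProbabilityMeasure (FS s)) →
    expectedOpt FB FS ≤ ENNReal.ofReal α * M.expectedWelfare σ FB FS

namespace ReserveRehearsal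

/-- Tie-breaking: the `n` buyer bids (`inl`) and the `n` buyer samples (`inr`) receive distinct
tickets. -/
abbrev Tickets (n : ℕ) : Type := (Fin n ⊕ Fin n) ≃ Fin (n + n)

/-- A number with its ticket, compared by the number first and by the ticket among equal
numbers. -/
abbrev Ticketed (n : ℕ) : Type := ℝ≥0 ×ₗ Fin (n + n)

/-- The number of largest samples that are used, `k - 2√k` with `2√k` rounded down, but at
least one. -/
def numTop (k : ℕ) : ℕ := max 1 (k - Nat.sqrt (4 * k))

/-- The buyer samples with their tickets, in decreasing order. -/
def sortedSamples {n : ℕ} (c : Tickets n) (smpB : Fin n → ℝ≥0) : List (Ticketed n) :=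
  (List.ofFn fun b => (toLex (smpB b, c (Sum.inr b)) : Ticketed n)).mergeSort
    (fun x y => decide (y ≤ x))

/-- The initial list `P`, in decreasing order, of `k` thresholds: the `numTop k` largest buyer
samples, the last of them being repeated until the list has length `k`. -/
def thresholds {n : ℕ} (k : ℕ) (c : Tickets n) (smpB : Fin n → ℝ≥0) : List (Ticketed n) :=
  (List.range k).filterMap fun i => (sortedSamples c smpB)[min i (numTop k - 1)]?

/-- A proposal to `buyer` and `seller` to trade the seller's item at `price`. -/
structure Proposal (n m : ℕ) where
  buyer : Fin n
  seller : Fin m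
  price : ℝ≥0

/-- The proposals that are made when the buyers in the first list and the sellers in the last list
are still to arrive, and `P` is the decreasing list of thresholds that are left. The current
minimum `p_min` of `P` is its last element. A buyer whose ticketed bid exceeds `p_min` removes from
`P` the highest threshold below it, which is the first such element of the list, and is proposed a
trade with the next seller at the larger of `p_min` and this seller's sample. -/
def proposals {n m : ℕ} (bid : Fin n → Ticketed n) (smpS : Fin m → ℝ≥0) :
    List (Fin n) → List (Ticketed n) → List (Fin m) → List (Proposal n m)
  | b :: bs, P, s :: ss =>
    match P.getLast? with
    | some pmin =>
      if pmin < bid b then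
        ⟨b, s, max (smpS s) (ofLex pmin).1⟩ ::
          proposals bid smpS bs (P.eraseP fun p => decide (p < bid b)) ss
      else proposals bid smpS bs P (s :: ss)
    | none => []
  | _, _, _ => []

/-- The proposals that both sides agree to: the price is at most the buyer's bid and at least the
seller's bid. -/
def trades {n m : ℕ} (smp bids : Profile n m) (σ : Equiv.Perm (Fin n)) (c : Tickets n)
    (π : Equiv.Perm (Fin m)) : List (Proposal n m) :=
  (proposals (fun b => toLex (bids.1 b, c (Sum.inl b))) smp.2 (List.ofFn σ)
    (thresholds (min n m) c smp.1) (List.ofFn π)).filter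
    fun q => decide (q.price ≤ bids.1 q.buyer ∧ bids.2 q.seller ≤ q.price)

end ReserveRehearsal

open ReserveRehearsal in
/-- The Reserve Rehearsal mechanism, with ties among buyer bids and buyer samples broken uniformly
at random. -/
def reserveRehearsal (n m : ℕ) : SingleSampleMechanism n m where
  Coin := Tickets n
  nonemptyCoin := ⟨finSumFinEquiv⟩
  outcome smp bids σ c π :=
    { alloc := fun s =>
        ((trades smp bids σ c π).find? fun q => decide (q.seller = s)).map Proposal.buyer
      payB := fun b =>
        match (trades smp bids σ c π).find? fun q => decide (q.buyer = b) with
        | some q => (q.price : ℝ)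
        | none => 0
      payS := fun s =>
        match (trades smp bids σ c π).find? fun q => decide (q.seller = s) with
        | some q => (q.price : ℝ)
        | none => 0 }

end

/-!
Everything except the approximation ratio holds run by run and is read off the list of proposals.
The buyers' side of the mechanism (`rehearse`) never looks at the sellers, and the approached buyers
are simply zipped with the sellers in order of arrival (`proposals_eq`). So buyers and sellers in
the list of proposals are distinct, a bid never influences the price offered to its owner
(`exists_menu` for buyers), and the proposals to the first `t` buyers are an initial segment of the
list that depends on nothing that comes later (`trades_eq_append`).

For the ratio, write `k = min n m`. The optimum is at most the total value of the sellers plus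
`topSum k`, the value of the best `k` buyers (`optWelfare_le`), and trades never decrease welfare,
so it remains to compare `topSum k` with the welfare of the mechanism. This is done by averaging
over exchanges of values with samples, which preserve the law (`measurePreserving_exchange`).

Exchanging all sellers' values with their samples turns one half of the value of the approached
buyers into a lower bound on welfare: if the buyer's value is `x` and the two numbers of the seller
are `s` and `s'`, then in one of the two assignments either the trade takes place or the seller
keeps an item worth at least `x` (`le_add_of_exchange`).

Exchanging bid and sample of each buyer by a fair coin reduces the buyers' side to a statement about
the `2 * n` fixed numbers in decreasing order, each labelled bid or sample. The best `k` bids are on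
average worth at most half of the `2 * k` largest numbers (`expect_topSum_le`). By Abel summation it
suffices that among the `l` largest numbers, for each `l ≤ 2 * k`, at least `0.27 * l` are on
average bids of approached buyers. Let the walk `D` be the number of bids minus the number of
samples among the first positions. Labels of different numbers are non-positively correlated, so
`D` at `l` has second moment at most `l` (`expect_walk_sq_le`), and odd moments vanish.

* For large `l`: an approached buyer uses up the highest threshold below her bid, hence the number
  of approached bids is at least the number of thresholds plus the minimum of `D` up to `l`
  (`exists_min_add_walk_le`), and this minimum is of smaller order than `l`
  (`expect_sum_acc_ge_of_large`).
* For bounded `l`: a bid among the largest numbers is rejected only if almost all `k` thresholds are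
  used up, although only about `k - 2√k` samples serve as thresholds. Then `D` is at least about
  `2√k` near position `2 * k`, and by a one-sided Chebyshev inequality this has probability at most
  about `1 / 3` (`expect_acc_ge_of_small`).

As `2 * (1 / 2) / 0.27 < 2 + √3 = 1 / (2 - √3)`, this proves the bound for large `k` even without
the term `C / √k`. For the remaining `k` the first threshold alone gives the ratio `8 * k`
(`expect_acc_zero_ge`), which a large `C` absorbs.
-/

namespace ReserveRehearsal

/-! ### The buyers' side of the mechanism -/

section Rehearse

variable {β τ τ' γ δ : Type*}

/-- The buyers' side of the mechanism, for thresholds of any type: `below p b` says that the bid of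
buyer `b` exceeds the threshold `p`. The list of the buyers who are approached, each with the
minimal threshold at that time. -/
def rehearse (below : τ → β → Bool) : List β → List τ → List (β × τ)
  | [], _ => []
  | b :: bs, P =>
    match P.getLast? with
    | some p =>
      if below p b then (b, p) :: rehearse below bs (P.eraseP fun p => below p b)
      else rehearse below bs P
    | none => []

/-- The thresholds that are left when the listed buyers have been processed. -/
def leftover (below : τ → β → Bool) : List β → List τ → List τ
  | [], P => P
  | b :: bs, P =>
    match P.getLast? with
    | some p =>
      if below p b then leftover below bs (P.eraseP fun p => below p b)
      else leftover below bs P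
    | none => P

theorem rehearse_nil_right (below : τ → β → Bool) (l : List β) : rehearse below l [] = [] := by
  cases l <;> rfl

theorem leftover_nil_right (below : τ → β → Bool) (l : List β) : leftover below l [] = [] := by
  cases l <;> rfl

theorem rehearse_append (below : τ → β → Bool) (l₁ l₂ : List β) (P : List τ) :
    rehearse below (l₁ ++ l₂) P =
      rehearse below l₁ P ++ rehearse below l₂ (leftover below l₁ P) := by
  induction l₁ generalizing P with
  | nil => rfl
  | cons b l ih =>
    rcases hP : P.getLast? with _ | p
    · rw [List.getLast?_eq_none_iff] at hP
      subst hP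
      simp [rehearse_nil_right, leftover_nil_right]
    · by_cases h : below p b <;> simp [rehearse, leftover, hP, h, ih]

theorem rehearse_congr {f g : τ → β → Bool} {l : List β} (h : ∀ p, ∀ b ∈ l, f p b = g p b)
    (P : List τ) : rehearse f l P = rehearse g l P ∧ leftover f l P = leftover g l P := by
  induction l generalizing P with
  | nil => exact ⟨rfl, rfl⟩
  | cons b l ih =>
    have hb' : ∀ p, f p b = g p b := fun p => h p b (by simp)
    have ih' := fun P => ih (fun p c hc => h p c (by simp [hc])) P
    simp only [rehearse, leftover, hb', fun P => (ih' P).1, fun P => (ih' P).2, and_self]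

theorem rehearse_map (key : τ → τ') (below : τ' → β → Bool) (l : List β) (P : List τ) :
    rehearse below l (P.map key) =
      (rehearse (fun i b => below (key i) b) l P).map (Prod.map id key) := by
  induction l generalizing P with
  | nil => rfl
  | cons b l ih =>
    rcases hP : P.getLast? with _ | p
    · simp [rehearse, hP]
    · by_cases h : below (key p) b
      · simp [rehearse, hP, h, List.eraseP_map, ih, Function.comp_def]
      · simp [rehearse, hP, h, ih]

theorem map_fst_rehearse_sublist (below : τ → β → Bool) (l : List β) (P : List τ) :
    ((rehearse below l P).map Prod.fst).Sublist l := by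
  induction l generalizing P with
  | nil => simp [rehearse]
  | cons b l ih =>
    rcases hP : P.getLast? with _ | p
    · simp [rehearse, hP]
    · by_cases h : below p b
      · simpa [rehearse, hP, h] using ih _
      · simpa [rehearse, hP, h] using (ih P).cons b

theorem length_rehearse_add_leftover (below : τ → β → Bool) (l : List β) (P : List τ) :
    (rehearse below l P).length + (leftover below l P).length = P.length := by
  induction l generalizing P with
  | nil => simp [rehearse, leftover]
  | cons b l ih =>
    rcases hP : P.getLast? with _ | p
    · simp [rehearse, leftover, hP]
    · by_cases h : below p b
      · have hp : p ∈ P := List.mem_of_getLast? hP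
        have := ih (P.eraseP fun p => below p b)
        have h2 := List.length_eraseP_add_one (p := fun p => below p b) hp h
        simp only [rehearse, leftover, hP, h, if_true, List.length_cons]
        omega
      · simp [rehearse, leftover, hP, h, ih]

theorem zipWith_append_left (f : γ → δ → β) (R₁ R₂ : List γ) (ss : List δ) :
    List.zipWith f (R₁ ++ R₂) ss =
      List.zipWith f R₁ (ss.take R₁.length) ++ List.zipWith f R₂ (ss.drop R₁.length) := by
  induction R₁ generalizing ss with
  | nil => simp
  | cons a R ih => cases ss <;> simp [ih]

end Rehearse

variable {n m : ℕ}

/-- The comparison of a threshold with a bid that the mechanism uses. -/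
noncomputable abbrev Below (bid : Fin n → Ticketed n) (p : Ticketed n) (b : Fin n) : Bool :=
  decide (p < bid b)

/-- The proposal to an approached buyer and a seller. -/
noncomputable def propose (smpS : Fin m → ℝ≥0) (x : Fin n × Ticketed n) (s : Fin m) : Proposal n m :=
  ⟨x.1, s, max (smpS s) (ofLex x.2).1⟩

/-- Which buyers are approached depends on the buyers alone, and the approached buyers meet the
sellers in order of arrival. -/
theorem proposals_eq (bid : Fin n → Ticketed n) (smpS : Fin m → ℝ≥0) (bs : List (Fin n))
    (P : List (Ticketed n)) (ss : List (Fin m)) :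
    proposals bid smpS bs P ss =
      List.zipWith (propose smpS) (rehearse (Below bid) bs P) ss := by
  induction bs generalizing P ss with
  | nil => simp [proposals, rehearse]
  | cons b bs ih =>
    cases ss with
    | nil => simp [proposals]
    | cons s ss =>
      rcases hP : P.getLast? with _ | p
      · simp [proposals, rehearse, hP]
      · by_cases h : p < bid b
        · simp [proposals, rehearse, hP, h, ih, propose]
        · simp [proposals, rehearse, hP, h, ih]

/-- The ticketed bids. -/
noncomputable abbrev ticketedBid (bids : Profile n m) (c : Tickets n) (b : Fin n) : Ticketed n :=
  toLex (bids.1 b, c (Sum.inl b))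

/-- All proposals of one run of the mechanism. -/
noncomputable abbrev allProposals (smp bids : Profile n m) (σ : Equiv.Perm (Fin n)) (c : Tickets n)
    (π : Equiv.Perm (Fin m)) : List (Proposal n m) :=
  proposals (ticketedBid bids c) smp.2 (List.ofFn σ) (thresholds (min n m) c smp.1) (List.ofFn π)

/-- Both sides agree to the proposal. -/
abbrev Agreed (bids : Profile n m) (q : Proposal n m) : Prop :=
  q.price ≤ bids.1 q.buyer ∧ bids.2 q.seller ≤ q.price

theorem trades_eq (smp bids : Profile n m) (σ : Equiv.Perm (Fin n)) (c : Tickets n)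
    (π : Equiv.Perm (Fin m)) :
    trades smp bids σ c π =
      (allProposals smp bids σ c π).filter fun q => decide (Agreed bids q) := rfl

theorem zipWith_map_fst_sublist {γ δ ε β : Type*} (f : γ → δ → ε) (g : ε → β) (h : γ → β)
    (hg : ∀ x y, g (f x y) = h x) (R : List γ) (ss : List δ) :
    ((List.zipWith f R ss).map g).Sublist (R.map h) := by
  induction R generalizing ss with
  | nil => simp
  | cons a R ih =>
    cases ss with
    | nil => simp
    | cons s ss => simpa only [List.zipWith_cons_cons, List.map_cons, hg] using (ih ss).cons_cons _

theorem zipWith_map_snd_sublist {γ δ ε : Type*} (f : γ → δ → ε) (g : ε → δ)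
    (hg : ∀ x y, g (f x y) = y) (R : List γ) (ss : List δ) :
    ((List.zipWith f R ss).map g).Sublist ss := by
  induction R generalizing ss with
  | nil => simp
  | cons a R ih =>
    cases ss with
    | nil => simp
    | cons s ss => simpa only [List.zipWith_cons_cons, List.map_cons, hg] using (ih ss).cons_cons _

theorem map_buyer_proposals_sublist (bid : Fin n → Ticketed n) (smpS : Fin m → ℝ≥0)
    (bs : List (Fin n)) (P : List (Ticketed n)) (ss : List (Fin m)) :
    ((proposals bid smpS bs P ss).map Proposal.buyer).Sublist bs := by
  rw [proposals_eq]
  exact (zipWith_map_fst_sublist (propose smpS) _ Prod.fst (fun _ _ => rfl) _ _).trans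
    (map_fst_rehearse_sublist _ _ _)

theorem map_seller_proposals_sublist (bid : Fin n → Ticketed n) (smpS : Fin m → ℝ≥0)
    (bs : List (Fin n)) (P : List (Ticketed n)) (ss : List (Fin m)) :
    ((proposals bid smpS bs P ss).map Proposal.seller).Sublist ss := by
  rw [proposals_eq]
  exact zipWith_map_snd_sublist (propose smpS) _ (fun _ _ => rfl) _ _

theorem nodup_ofFn_perm {k : ℕ} (σ : Equiv.Perm (Fin k)) : (List.ofFn σ).Nodup :=
  List.nodup_ofFn.2 σ.injective

theorem nodup_buyer_allProposals (smp bids : Profile n m) (σ : Equiv.Perm (Fin n))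
    (c : Tickets n) (π : Equiv.Perm (Fin m)) :
    ((allProposals smp bids σ c π).map Proposal.buyer).Nodup :=
  (map_buyer_proposals_sublist _ _ _ _ _).nodup (nodup_ofFn_perm σ)

theorem nodup_seller_allProposals (smp bids : Profile n m) (σ : Equiv.Perm (Fin n))
    (c : Tickets n) (π : Equiv.Perm (Fin m)) :
    ((allProposals smp bids σ c π).map Proposal.seller).Nodup :=
  (map_seller_proposals_sublist _ _ _ _ _).nodup (nodup_ofFn_perm π)

theorem nodup_buyer_trades (smp bids : Profile n m) (σ : Equiv.Perm (Fin n))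
    (c : Tickets n) (π : Equiv.Perm (Fin m)) :
    ((trades smp bids σ c π).map Proposal.buyer).Nodup :=
  (List.filter_sublist.map _).nodup (nodup_buyer_allProposals smp bids σ c π)

theorem nodup_seller_trades (smp bids : Profile n m) (σ : Equiv.Perm (Fin n))
    (c : Tickets n) (π : Equiv.Perm (Fin m)) :
    ((trades smp bids σ c π).map Proposal.seller).Nodup :=
  (List.filter_sublist.map _).nodup (nodup_seller_allProposals smp bids σ c π)

theorem find?_eq_some_iff_of_nodup {γ δ : Type*} [DecidableEq δ] (g : γ → δ) {l : List γ}
    (hl : (l.map g).Nodup) (x : δ) (q : γ) :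
    l.find? (fun a => decide (g a = x)) = some q ↔ q ∈ l ∧ g q = x := by
  constructor
  · intro h
    exact ⟨List.mem_of_find?_eq_some h, by simpa using List.find?_some h⟩
  · rintro ⟨hq, hx⟩
    rcases h : l.find? (fun a => decide (g a = x)) with _ | r
    · exact absurd hx (by simpa using List.find?_eq_none.1 h q hq)
    · have h1 := List.mem_of_find?_eq_some h
      have h2 : g r = x := by simpa using List.find?_some h
      rw [List.inj_on_of_nodup_map hl h1 hq (h2.trans hx.symm)]

theorem sum_find?_eq {γ δ : Type*} [DecidableEq δ] [Fintype δ] (g : γ → δ) (f : γ → ℝ)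
    {l : List γ} (hl : (l.map g).Nodup) :
    ∑ x, ((l.find? fun a => decide (g a = x)).elim 0 f) = (l.map f).sum := by
  induction l with
  | nil => simp
  | cons a l ih =>
    have hl' := List.nodup_cons.1 hl
    rw [List.map_cons, List.sum_cons, ← ih hl'.2,
      ← Finset.add_sum_erase Finset.univ _ (Finset.mem_univ (g a)),
      ← Finset.add_sum_erase Finset.univ (fun x => ((l.find? fun a => decide (g a = x)).elim 0 f))
        (Finset.mem_univ (g a))]
    have h0 : l.find? (fun b => decide (g b = g a)) = none := by
      rw [List.find?_eq_none]
      intro y hy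
      have : g y ≠ g a := fun h => hl'.1 (h ▸ List.mem_map_of_mem hy)
      simpa using this
    have h1 : ∀ x ∈ Finset.univ.erase (g a), ((a :: l).find? fun a => decide (g a = x)).elim 0 f =
        (l.find? fun a => decide (g a = x)).elim 0 f := by
      intro x hx
      rw [List.find?_cons_of_neg]
      simpa using (Finset.ne_of_mem_erase hx).symm
    rw [Finset.sum_congr rfl h1, h0]
    simp

section Outcome

variable (smp bids : Profile n m) (σ : Equiv.Perm (Fin n)) (c : Tickets n)
  (π : Equiv.Perm (Fin m))

theorem payB_eq (b : Fin n) : ((reserveRehearsal n m).outcome smp bids σ c π).payB b =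
    ((trades smp bids σ c π).find? fun q => decide (q.buyer = b)).elim 0
      fun q => (q.price : ℝ) := by
  change (match (trades smp bids σ c π).find? fun q => decide (q.buyer = b) with
        | some q => (q.price : ℝ)
        | none => 0) = _
  cases (trades smp bids σ c π).find? fun q => decide (q.buyer = b) <;> rfl

theorem payS_eq (s : Fin m) : ((reserveRehearsal n m).outcome smp bids σ c π).payS s =
    ((trades smp bids σ c π).find? fun q => decide (q.seller = s)).elim 0
      fun q => (q.price : ℝ) := by
  change (match (trades smp bids σ c π).find? fun q => decide (q.seller = s) with
        | some q => (q.price : ℝ)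
        | none => 0) = _
  cases (trades smp bids σ c π).find? fun q => decide (q.seller = s) <;> rfl

theorem alloc_eq (s : Fin m) : ((reserveRehearsal n m).outcome smp bids σ c π).alloc s =
    ((trades smp bids σ c π).find? fun q => decide (q.seller = s)).map Proposal.buyer := rfl

theorem alloc_eq_some_iff (s : Fin m) (b : Fin n) :
    ((reserveRehearsal n m).outcome smp bids σ c π).alloc s = some b ↔
      ∃ q ∈ trades smp bids σ c π, q.seller = s ∧ q.buyer = b := by
  rw [alloc_eq, Option.map_eq_some_iff]
  simp only [find?_eq_some_iff_of_nodup _ (nodup_seller_trades smp bids σ c π)]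
  simp [and_assoc]

theorem alloc_eq_none_iff (s : Fin m) :
    ((reserveRehearsal n m).outcome smp bids σ c π).alloc s = none ↔
      ∀ q ∈ trades smp bids σ c π, q.seller ≠ s := by
  rw [alloc_eq, Option.map_eq_none_iff, List.find?_eq_none]
  simp

theorem wins_iff (b : Fin n) : ((reserveRehearsal n m).outcome smp bids σ c π).alloc.Wins b ↔
    ∃ q ∈ trades smp bids σ c π, q.buyer = b := by
  simp only [Allocation.Wins, alloc_eq_some_iff]
  constructor
  · rintro ⟨s, q, hq, -, hb⟩
    exact ⟨q, hq, hb⟩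
  · rintro ⟨q, hq, hb⟩
    exact ⟨q.seller, q, hq, rfl, hb⟩

theorem buyerUtility_of_mem {q : Proposal n m} (hq : q ∈ trades smp bids σ c π) (v : ℝ≥0) :
    ((reserveRehearsal n m).outcome smp bids σ c π).buyerUtility q.buyer v = v - q.price := by
  rw [Outcome.buyerUtility, if_pos ((wins_iff _ _ _ _ _ _).2 ⟨q, hq, rfl⟩), payB_eq,
    (find?_eq_some_iff_of_nodup _ (nodup_buyer_trades smp bids σ c π) _ q).2 ⟨hq, rfl⟩]
  rfl

theorem buyerUtility_of_forall_ne {b : Fin n} (hb : ∀ q ∈ trades smp bids σ c π, q.buyer ≠ b)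
    (v : ℝ≥0) : ((reserveRehearsal n m).outcome smp bids σ c π).buyerUtility b v = 0 := by
  rw [Outcome.buyerUtility, if_neg, payB_eq, List.find?_eq_none.2]
  · simp
  · simpa using hb
  · rw [wins_iff]
    rintro ⟨q, hq, h⟩
    exact hb q hq h

theorem sellerUtility_of_mem {q : Proposal n m} (hq : q ∈ trades smp bids σ c π) (v : ℝ≥0) :
    ((reserveRehearsal n m).outcome smp bids σ c π).sellerUtility q.seller v = q.price := by
  rw [Outcome.sellerUtility, if_neg, payS_eq,
    (find?_eq_some_iff_of_nodup _ (nodup_seller_trades smp bids σ c π) _ q).2 ⟨hq, rfl⟩]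
  · rfl
  · rw [alloc_eq_none_iff]
    exact fun h => h q hq rfl

theorem sellerUtility_of_forall_ne {s : Fin m} (hs : ∀ q ∈ trades smp bids σ c π, q.seller ≠ s)
    (v : ℝ≥0) : ((reserveRehearsal n m).outcome smp bids σ c π).sellerUtility s v = v := by
  rw [Outcome.sellerUtility, if_pos]
  rwa [alloc_eq_none_iff]

theorem mem_trades {q : Proposal n m} : q ∈ trades smp bids σ c π ↔
    q ∈ allProposals smp bids σ c π ∧ Agreed bids q := by
  rw [trades_eq, List.mem_filter, decide_eq_true_eq]

end Outcome

/-! ### Budget balance, individual rationality and incentives -/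

theorem keepersUnpaid (n m : ℕ) : (reserveRehearsal n m).KeepersUnpaid := by
  intro smp bids σ c π s h
  have h' := Option.map_eq_none_iff.1 ((alloc_eq smp bids σ c π s).symm.trans h)
  exact (payS_eq smp bids σ c π s).trans (by rw [h']; rfl)

theorem isExPostSBB (n m : ℕ) : (reserveRehearsal n m).IsExPostSBB := by
  intro smp v σ c π
  have hB := Finset.sum_congr rfl fun b (_ : b ∈ Finset.univ) => payB_eq smp v σ c π b
  have hS := Finset.sum_congr rfl fun s (_ : s ∈ Finset.univ) => payS_eq smp v σ c π s
  refine (congrArg₂ _ hB hS).trans ?_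
  rw [sum_find?_eq _ _ (nodup_buyer_trades smp v σ c π),
    sum_find?_eq _ _ (nodup_seller_trades smp v σ c π), sub_self]

theorem isExPostIR (n m : ℕ) : (reserveRehearsal n m).IsExPostIR := by
  intro smp v σ c π
  constructor
  · intro b
    by_cases h : ∃ q ∈ trades smp v σ c π, q.buyer = b
    · obtain ⟨q, hq, rfl⟩ := h
      rw [buyerUtility_of_mem _ _ _ _ _ hq, sub_nonneg]
      exact_mod_cast ((mem_trades _ _ _ _ _).1 hq).2.1
    · push Not at h
      rw [buyerUtility_of_forall_ne _ _ _ _ _ h]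
  · intro s
    by_cases h : ∃ q ∈ trades smp v σ c π, q.seller = s
    · obtain ⟨q, hq, rfl⟩ := h
      rw [sellerUtility_of_mem _ _ _ _ _ hq]
      exact_mod_cast ((mem_trades _ _ _ _ _).1 hq).2.2
    · push Not at h
      rw [sellerUtility_of_forall_ne _ _ _ _ _ h]

/-- The seller's bid has no influence on the proposals, only on whether she agrees. -/
theorem sellerUtility_le_truthful (smp bids : Profile n m) (σ : Equiv.Perm (Fin n))
    (c : Tickets n) (π : Equiv.Perm (Fin m)) (s : Fin m) (v : ℝ≥0) :
    ((reserveRehearsal n m).outcome smp bids σ c π).sellerUtility s v ≤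
      ((reserveRehearsal n m).outcome smp (bids.1, Function.update bids.2 s v)
        σ c π).sellerUtility s v := by
  set bids' : Profile n m := (bids.1, Function.update bids.2 s v) with hbids'
  have hir := (isExPostIR n m smp bids' σ c π).2 s
  have hv : bids'.2 s = v := by simp [hbids']
  rw [hv] at hir
  by_cases h : ∃ q ∈ trades smp bids σ c π, q.seller = s
  · obtain ⟨q, hq, hs⟩ := h
    have hq' := (mem_trades _ _ _ _ _).1 hq
    rw [← hs, sellerUtility_of_mem _ _ _ _ _ hq, hs]
    by_cases hp : v ≤ q.price
    · have hmem : q ∈ trades smp bids' σ c π := by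
        refine (mem_trades _ _ _ _ _).2 ⟨hq'.1, hq'.2.1, ?_⟩
        rw [hs, hv]
        exact hp
      rw [← hs, sellerUtility_of_mem _ _ _ _ _ hmem]
    · refine le_trans ?_ hir
      exact_mod_cast (not_le.1 hp).le
  · push Not at h
    rwa [sellerUtility_of_forall_ne _ _ _ _ _ h]

/-- When buyer `b` is processed, the minimal threshold and the next seller do not depend on her
bid: she is made the proposal determined by them exactly if her bid exceeds this threshold. -/
theorem exists_menu (bid : Fin n → Ticketed n) (smpS : Fin m → ℝ≥0) (σ : Equiv.Perm (Fin n))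
    (P : List (Ticketed n)) (ss : List (Fin m)) (b : Fin n) :
    ∃ o : Option (Ticketed n × Fin m), ∀ bid' : Fin n → Ticketed n,
      (∀ b', b' ≠ b → bid' b' = bid b') → ∀ q : Proposal n m,
      (q ∈ proposals bid' smpS (List.ofFn σ) P ss ∧ q.buyer = b ↔
        ∃ x, o = some x ∧ x.1 < bid' b ∧ q = propose smpS (b, x.1) x.2) := by
  have hb : b ∈ List.ofFn σ := by
    rw [List.mem_ofFn]
    exact σ.surjective b
  obtain ⟨l₁, l₂, hl⟩ := List.append_of_mem hb
  have hnd := nodup_ofFn_perm σ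
  rw [hl, List.nodup_append] at hnd
  have h1 : ∀ b' ∈ l₁, b' ≠ b := fun b' h => hnd.2.2 b' h b (by simp)
  have h2 : b ∉ l₂ := (List.nodup_cons.1 hnd.2.1).1
  set R₁ := rehearse (Below bid) l₁ P
  set P₁ := leftover (Below bid) l₁ P
  refine ⟨P₁.getLast?.bind fun p => ((ss.drop R₁.length).head?).map fun s => (p, s), ?_⟩
  intro bid' hbid' q
  have hc := rehearse_congr (f := Below bid') (g := Below bid) (l := l₁)
    (fun p b' h => by rw [Below, Below, hbid' b' (h1 b' h)]) P
  rw [proposals_eq, hl, rehearse_append, hc.1, hc.2, zipWith_append_left, List.mem_append]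
  have hfirst : ∀ ss' : List (Fin m), ¬(q ∈ List.zipWith (propose smpS) R₁ ss' ∧ q.buyer = b) := by
    rintro ss' ⟨hq, hqb⟩
    have := (zipWith_map_fst_sublist (propose smpS) Proposal.buyer Prod.fst (fun _ _ => rfl)
      R₁ ss').trans (map_fst_rehearse_sublist _ _ _)
    exact h1 _ (this.subset (List.mem_map_of_mem hq)) hqb
  have hlast : ∀ (P' : List (Ticketed n)) (ss' : List (Fin m)),
      ¬(q ∈ List.zipWith (propose smpS) (rehearse (Below bid') l₂ P') ss' ∧ q.buyer = b) := by
    rintro P' ss' ⟨hq, hqb⟩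
    have := (zipWith_map_fst_sublist (propose smpS) Proposal.buyer Prod.fst (fun _ _ => rfl)
      (rehearse (Below bid') l₂ P') ss').trans (map_fst_rehearse_sublist _ _ _)
    exact h2 (hqb ▸ this.subset (List.mem_map_of_mem hq))
  change (_ ∨ q ∈ List.zipWith (propose smpS) (rehearse (Below bid') (b :: l₂) P₁)
    (ss.drop R₁.length)) ∧ _ ↔ _
  rw [or_and_right, or_iff_right (hfirst _)]
  rcases hP₁ : P₁.getLast? with _ | p
  · simp [rehearse, hP₁]
  rcases hss : ss.drop R₁.length with _ | ⟨s, ss'⟩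
  · simp
  by_cases hlt : p < bid' b
  · simp only [rehearse, hP₁, Below, hlt, decide_true, if_true, List.zipWith_cons_cons,
      List.mem_cons, or_and_right]
    rw [or_iff_left (hlast _ _)]
    simp only [Option.bind_some, List.head?_cons, Option.map_some, Option.some.injEq,
      exists_eq_left', hlt, true_and]
    exact ⟨fun h => h.1, fun h => ⟨h, by rw [h]; rfl⟩⟩
  · simp only [rehearse, hP₁, Below, hlt, decide_false]
    have := hlast P₁ (s :: ss')
    simp only [Bool.false_eq_true, if_false, this, false_iff]
    simp [hlt]

/-- A buyer faces a take-it-or-leave-it price that does not depend on her bid, and she is offered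
it exactly if her ticketed bid exceeds a threshold of at most this price. -/
theorem buyerUtility_le_truthful (smp bids : Profile n m) (σ : Equiv.Perm (Fin n))
    (c : Tickets n) (π : Equiv.Perm (Fin m)) (b : Fin n) (v : ℝ≥0) :
    ((reserveRehearsal n m).outcome smp bids σ c π).buyerUtility b v ≤
      ((reserveRehearsal n m).outcome smp (Function.update bids.1 b v, bids.2)
        σ c π).buyerUtility b v := by
  set bids' : Profile n m := (Function.update bids.1 b v, bids.2) with hbids'
  have hv : bids'.1 b = v := by simp [hbids']
  have hir := (isExPostIR n m smp bids' σ c π).1 b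
  rw [hv] at hir
  by_cases h : ∃ q ∈ trades smp bids σ c π, q.buyer = b
  · obtain ⟨q, hq, hb⟩ := h
    have hq' := (mem_trades _ _ _ _ _).1 hq
    have hu := buyerUtility_of_mem _ _ _ _ _ hq v
    rw [hb] at hu
    rw [hu]
    by_cases hp : q.price < v
    · obtain ⟨o, ho⟩ := exists_menu (ticketedBid bids c) smp.2 σ (thresholds (min n m) c smp.1)
        (List.ofFn π) b
      obtain ⟨x, hx, -, hqx⟩ := (ho _ (fun _ _ => rfl) q).1 ⟨hq'.1, hb⟩
      have hq2 : q ∈ allProposals smp bids' σ c π := by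
        refine ((ho (ticketedBid bids' c) ?_ q).2 ⟨x, hx, ?_, hqx⟩).1
        · intro b' hb'
          change toLex (Function.update bids.1 b v b', _) = _
          rw [Function.update_of_ne hb']
        · rw [Prod.Lex.lt_iff]
          left
          change (ofLex x.1).1 < bids'.1 b
          rw [hv]
          refine lt_of_le_of_lt ?_ hp
          rw [hqx]
          exact le_max_right _ _
      have hmem : q ∈ trades smp bids' σ c π :=
        (mem_trades _ _ _ _ _).2 ⟨hq2, by rw [hb, hv]; exact hp.le, hq'.2.2⟩
      have hu' := buyerUtility_of_mem _ _ _ _ _ hmem v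
      rw [hb] at hu'
      rw [hu']
    · refine le_trans ?_ hir
      rw [sub_nonpos]
      exact_mod_cast not_lt.1 hp
  · push Not at h
    rwa [buyerUtility_of_forall_ne _ _ _ _ _ h]

theorem isDSIC (n m : ℕ) : (reserveRehearsal n m).IsDSIC := fun smp bids σ =>
  ⟨fun b v => Finset.expect_le_expect fun x _ =>
      buyerUtility_le_truthful smp bids σ x.1 x.2 b v,
    fun s v => Finset.expect_le_expect fun x _ =>
      sellerUtility_le_truthful smp bids σ x.1 x.2 s v⟩

theorem isSBB (n m : ℕ) : (reserveRehearsal n m).IsSBB := by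
  intro smp v σ
  exact (Finset.expect_congr rfl fun x _ => isExPostSBB n m smp v σ x.1 x.2).trans (by simp)

theorem isIR (n m : ℕ) : (reserveRehearsal n m).IsIR := by
  intro smp v σ
  refine ⟨fun b => Finset.expect_nonneg fun x _ => (isExPostIR n m smp v σ x.1 x.2).1 b,
    fun s => ?_⟩
  have : Nonempty (reserveRehearsal n m).Coin := (reserveRehearsal n m).nonemptyCoin
  exact Finset.le_expect Finset.univ_nonempty fun x _ => (isExPostIR n m smp v σ x.1 x.2).2 s

/-! ### Online processing -/

/-- The buyers who are approached among the first `t` to arrive. -/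
noncomputable abbrev approached (smp bids : Profile n m) (σ : Equiv.Perm (Fin n)) (c : Tickets n)
    (t : ℕ) : List (Fin n × Ticketed n) :=
  rehearse (Below (ticketedBid bids c)) ((List.ofFn σ).take t) (thresholds (min n m) c smp.1)

/-- The approached buyers among those who arrive after the first `t`. -/
noncomputable abbrev approachedLater (smp bids : Profile n m) (σ : Equiv.Perm (Fin n))
    (c : Tickets n) (t : ℕ) : List (Fin n × Ticketed n) :=
  rehearse (Below (ticketedBid bids c)) ((List.ofFn σ).drop t)
    (leftover (Below (ticketedBid bids c)) ((List.ofFn σ).take t)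
      (thresholds (min n m) c smp.1))

theorem allProposals_eq_append (smp bids : Profile n m) (σ : Equiv.Perm (Fin n)) (c : Tickets n)
    (π : Equiv.Perm (Fin m)) (t : ℕ) :
    allProposals smp bids σ c π =
      List.zipWith (propose smp.2) (approached smp bids σ c t)
        ((List.ofFn π).take (approached smp bids σ c t).length) ++
      List.zipWith (propose smp.2) (approachedLater smp bids σ c t)
        ((List.ofFn π).drop (approached smp bids σ c t).length) := by
  rw [← zipWith_append_left, ← rehearse_append, List.take_append_drop, ← proposals_eq]

theorem approached_prefix (smp bids : Profile n m) (σ : Equiv.Perm (Fin n)) (c : Tickets n)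
    {t t' : ℕ} (h : t ≤ t') :
    approached smp bids σ c t <+: approached smp bids σ c t' := by
  obtain ⟨l, hl⟩ := List.take_prefix_take_left (l := List.ofFn σ) h
  rw [approached, approached, ← hl, rehearse_append]
  exact List.prefix_append _ _

theorem mem_take_ofFn {k : ℕ} (σ : Equiv.Perm (Fin k)) (t : ℕ) (j : Fin k) :
    σ j ∈ (List.ofFn σ).take t ↔ (j : ℕ) < t := by
  rw [List.mem_take_iff_getElem]
  constructor
  · rintro ⟨i, hi, h⟩
    rw [List.getElem_ofFn] at h
    have := congrArg Fin.val (σ.injective h)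
    simp only at this
    omega
  · intro h
    exact ⟨j, by simp [h], by simp⟩

theorem mem_drop_ofFn {k : ℕ} (σ : Equiv.Perm (Fin k)) (t : ℕ) (j : Fin k) :
    σ j ∈ (List.ofFn σ).drop t ↔ t ≤ (j : ℕ) := by
  rw [List.mem_drop_iff_getElem]
  constructor
  · rintro ⟨i, hi, h⟩
    rw [List.getElem_ofFn] at h
    have := congrArg Fin.val (σ.injective h)
    simp only at this
    omega
  · intro h
    refine ⟨j - t, by have := j.2; simp; omega, ?_⟩
    rw [List.getElem_ofFn]
    congr 1
    ext
    simp
    omega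

theorem take_ofFn_congr {k : ℕ} {σ σ' : Equiv.Perm (Fin k)} {t : ℕ}
    (h : ∀ j : Fin k, (j : ℕ) < t → σ' j = σ j) :
    (List.ofFn σ').take t = (List.ofFn σ).take t := by
  apply List.ext_getElem
  · simp
  · intro i h1 h2
    simp only [List.length_take, List.length_ofFn, lt_inf_iff] at h1
    simp only [List.getElem_take, List.getElem_ofFn]
    exact h _ h1.1

theorem buyer_mem_of_mem_zipWith {smpS : Fin m → ℝ≥0} {f : Ticketed n → Fin n → Bool}
    {l : List (Fin n)} {P : List (Ticketed n)} {ss : List (Fin m)} {q : Proposal n m}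
    (hq : q ∈ List.zipWith (propose smpS) (rehearse f l P) ss) : q.buyer ∈ l ∧ q.seller ∈ ss :=
  ⟨((zipWith_map_fst_sublist (propose smpS) Proposal.buyer Prod.fst (fun _ _ => rfl) _ ss).trans
      (map_fst_rehearse_sublist f l P)).subset (List.mem_map_of_mem hq),
    (zipWith_map_snd_sublist (propose smpS) Proposal.seller (fun _ _ => rfl) _ ss).subset
      (List.mem_map_of_mem hq)⟩

/-- The trades among the first `t` buyers to arrive come first, and the remaining trades involve
neither these buyers nor the sellers they were proposed to. -/
theorem trades_eq_append (smp bids : Profile n m) (σ : Equiv.Perm (Fin n)) (c : Tickets n)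
    (π : Equiv.Perm (Fin m)) (t : ℕ) :
    ∃ T : List (Proposal n m), trades smp bids σ c π =
      (List.zipWith (propose smp.2) (approached smp bids σ c t)
        ((List.ofFn π).take (approached smp bids σ c t).length)).filter
          (fun q => decide (Agreed bids q)) ++ T ∧
      ∀ q ∈ T, q.buyer ∈ (List.ofFn σ).drop t ∧
        q.seller ∈ (List.ofFn π).drop (approached smp bids σ c t).length := by
  rw [trades_eq, allProposals_eq_append smp bids σ c π t, List.filter_append]
  refine ⟨_, rfl, fun q hq => ?_⟩
  exact buyer_mem_of_mem_zipWith (List.mem_filter.1 hq).1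

/-- The price of a proposal, and `0` if there is none. -/
noncomputable def priceOrZero (o : Option (Proposal n m)) : ℝ := o.elim 0 fun q => (q.price : ℝ)

theorem isOnline (n m : ℕ) : (reserveRehearsal n m).IsOnline := by
  refine ⟨fun smp bids σ c _ t => min m (approached smp bids σ c t).length, ?_⟩
  intro smp bids σ c π
  refine ⟨?_, fun t => min_le_left _ _, ?_, ?_⟩
  · intro t t' h
    exact min_le_min_left _ (approached_prefix smp bids σ c h).length_le
  · intro i j hij
    obtain ⟨q, hq, hs, hb⟩ := (alloc_eq_some_iff smp bids σ c π _ _).1 hij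
    constructor
    · -- A proposal made before the processing of `σ j` is not addressed to `σ j`.
      by_contra hlt
      rw [not_le, lt_min_iff] at hlt
      obtain ⟨T, hT, hT'⟩ := trades_eq_append smp bids σ c π j
      rw [hT, List.mem_append] at hq
      rcases hq with hq | hq
      · have := (buyer_mem_of_mem_zipWith (List.mem_filter.1 hq).1).1
        rw [hb, mem_take_ofFn] at this
        exact lt_irrefl _ this
      · have := (hT' q hq).2
        rw [hs, mem_drop_ofFn] at this
        omega
    · obtain ⟨T, hT, hT'⟩ := trades_eq_append smp bids σ c π (j + 1)
      rw [hT, List.mem_append] at hq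
      rcases hq with hq | hq
      · have := (buyer_mem_of_mem_zipWith (List.mem_filter.1 hq).1).2
        rw [hs, mem_take_ofFn] at this
        exact lt_min i.2 this
      · have := (hT' q hq).1
        rw [hb, mem_drop_ofFn] at this
        omega
  · intro t bids' σ' π' hB hS
    have htake := take_ofFn_congr (σ := σ) (σ' := σ') fun j hj => (hB j hj).1
    have happ : approached smp bids' σ' c t = approached smp bids σ c t := by
      unfold approached
      rw [htake]
      refine (rehearse_congr ?_ _).1
      intro p b hb
      obtain ⟨j, rfl⟩ := σ.surjective b
      rw [mem_take_ofFn] at hb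
      have := (hB j hb).2
      simp only [Below, ticketedBid, this]
    set R := approached smp bids σ c t with hR
    have htakeS : (List.ofFn π').take R.length = (List.ofFn π).take R.length :=
      take_ofFn_congr fun i hi => (hS i (lt_min i.2 hi)).1
    obtain ⟨T, hT, hT'⟩ := trades_eq_append smp bids σ c π t
    obtain ⟨U, hU, hU'⟩ := trades_eq_append smp bids' σ' c π' t
    rw [← hR] at hT hT'
    rw [happ, htakeS] at hU
    rw [happ] at hU'
    have hfilter : (List.zipWith (propose smp.2) R ((List.ofFn π).take R.length)).filter
          (fun q => decide (Agreed bids' q)) =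
        (List.zipWith (propose smp.2) R ((List.ofFn π).take R.length)).filter
          (fun q => decide (Agreed bids q)) := by
      apply List.filter_congr
      intro q hq
      obtain ⟨h1, h2⟩ := buyer_mem_of_mem_zipWith hq
      obtain ⟨j, hj⟩ := σ.surjective q.buyer
      obtain ⟨i, hi⟩ := π.surjective q.seller
      rw [← hj, mem_take_ofFn] at h1
      rw [← hi, mem_take_ofFn] at h2
      have e1 := (hB j h1).2
      have e2 := (hS i (lt_min i.2 h2)).2
      rw [hj] at e1
      rw [hi] at e2
      simp only [Agreed, e1, e2]
    rw [hfilter] at hU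
    have hbuyer : ∀ j : Fin n, (j : ℕ) < t →
        (trades smp bids' σ' c π').find? (fun q => decide (q.buyer = σ j)) =
          (trades smp bids σ c π).find? (fun q => decide (q.buyer = σ j)) := by
      intro j hj
      have h1 : T.find? (fun q => decide (q.buyer = σ j)) = none := by
        rw [List.find?_eq_none]
        intro q hq
        rw [decide_eq_true_eq]
        intro h
        have := (hT' q hq).1
        rw [h, mem_drop_ofFn] at this
        omega
      have h2 : U.find? (fun q => decide (q.buyer = σ j)) = none := by
        rw [List.find?_eq_none]
        intro q hq
        rw [decide_eq_true_eq]
        intro h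
        have := (hU' q hq).1
        rw [h, ← (hB j hj).1, mem_drop_ofFn] at this
        omega
      rw [hT, hU, List.find?_append, List.find?_append, h1, h2]
    have hseller : ∀ i : Fin m, (i : ℕ) < min m R.length →
        (trades smp bids' σ' c π').find? (fun q => decide (q.seller = π i)) =
          (trades smp bids σ c π).find? (fun q => decide (q.seller = π i)) := by
      intro i hi
      have hi' := (lt_min_iff.1 hi).2
      have h1 : T.find? (fun q => decide (q.seller = π i)) = none := by
        rw [List.find?_eq_none]
        intro q hq
        rw [decide_eq_true_eq]
        intro h
        have := (hT' q hq).2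
        rw [h, mem_drop_ofFn] at this
        omega
      have h2 : U.find? (fun q => decide (q.seller = π i)) = none := by
        rw [List.find?_eq_none]
        intro q hq
        rw [decide_eq_true_eq]
        intro h
        have := (hU' q hq).2
        rw [h, ← (hS i hi).1, mem_drop_ofFn] at this
        omega
      rw [hT, hU, List.find?_append, List.find?_append, h1, h2]
    refine ⟨congrArg (fun R => min m R.length) happ, fun j hj => ?_, fun i hi => ⟨?_, ?_⟩⟩
    · exact (payB_eq ..).trans ((congrArg (priceOrZero) (hbuyer j hj)).trans
        (payB_eq ..).symm)
    · exact (alloc_eq ..).trans ((congrArg (Option.map _) (hseller i hi)).trans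
        (alloc_eq ..).symm)
    · exact (payS_eq ..).trans ((congrArg (priceOrZero) (hseller i hi)).trans
        (payS_eq ..).symm)

/-! ### Which buyers are approached -/

section Greedy

variable {α β : Type*} [LinearOrder α]

/-- The comparison of thresholds with bids in a linear order. -/
abbrev Exceeds (bid : β → α) (p : α) (b : β) : Bool := decide (p < bid b)

theorem getLast?_le_of_pairwise {P : List α} (hP : P.Pairwise (· ≥ ·)) {p a : α}
    (hp : P.getLast? = some p) (ha : a ∈ P) : p ≤ a := by
  obtain ⟨l, rfl⟩ := List.getLast?_eq_some_iff.1 hp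
  rw [List.pairwise_append] at hP
  rcases List.mem_append.1 ha with h | h
  · exact hP.2.2 a h p (by simp)
  · exact (List.mem_singleton.1 h).ge

theorem leftover_sublist {τ : Type*} (below : τ → β → Bool) (l : List β) (P : List τ) :
    (leftover below l P).Sublist P := by
  induction l generalizing P with
  | nil => exact List.Sublist.refl _
  | cons b l ih =>
    rcases hP : P.getLast? with _ | p
    · simp [leftover, hP]
    · by_cases h : below p b
      · simpa [leftover, hP, h] using (ih _).trans List.eraseP_sublist
      · simpa [leftover, hP, h] using ih P

/-- An approached buyer uses up a threshold below her bid. -/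
theorem countP_le_countP_rehearse_add (bid : β → α) (l : List β) (P : List α) (u : α) :
    P.countP (fun p => decide (u ≤ p)) ≤
      (rehearse (Exceeds bid) l P).countP (fun x => decide (u < bid x.1)) +
        (leftover (Exceeds bid) l P).countP (fun p => decide (u ≤ p)) := by
  induction l generalizing P with
  | nil => simp [rehearse, leftover]
  | cons b l ih =>
    rcases hP : P.getLast? with _ | p
    · simp [rehearse, leftover, hP]
    · by_cases h : p < bid b
      · have hp : p ∈ P := List.mem_of_getLast? hP
        obtain ⟨a, l₁, l₂, -, ha, h2, h3⟩ :=
          List.exists_of_eraseP (p := fun p => decide (p < bid b)) hp (by simpa using h)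
        have := ih (P.eraseP fun p => decide (p < bid b))
        simp only [rehearse, leftover, hP, Exceeds, h, decide_true, if_true, List.countP_cons]
          at this ⊢
        rw [decide_eq_true_eq] at ha
        have hc : P.countP (fun p => decide (u ≤ p)) ≤
            (P.eraseP fun p => decide (p < bid b)).countP (fun p => decide (u ≤ p)) +
              if decide (u < bid b) = true then 1 else 0 := by
          rw [h3]
          conv_lhs => rw [h2]
          simp only [List.countP_append, List.countP_cons, decide_eq_true_eq]
          by_cases hu : u ≤ a
          · simp [hu, hu.trans_lt ha]; omega
          · simp [hu]
        omega
      · simpa [rehearse, leftover, hP, h] using ih P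

/-- While the threshold `a` is available, each buyer who bids more than `a` is approached and
uses up a threshold of at least `a`. -/
theorem countP_add_countP_leftover_le (bid : β → α) (l : List β) {P : List α}
    (hP : P.Pairwise (· ≥ ·)) {a : α} (ha : a ∈ leftover (Exceeds bid) l P) :
    l.countP (fun b => decide (a < bid b)) +
        (leftover (Exceeds bid) l P).countP (fun p => decide (a ≤ p)) ≤
      P.countP (fun p => decide (a ≤ p)) := by
  induction l generalizing P with
  | nil => simp [leftover]
  | cons b l ih =>
    have haP := (leftover_sublist _ _ _).subset ha
    rcases hlast : P.getLast? with _ | p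
    · rw [List.getLast?_eq_none_iff] at hlast
      simp [hlast] at haP
    · have hpa := getLast?_le_of_pairwise hP hlast haP
      by_cases h : p < bid b
      · simp only [leftover, hlast, Exceeds, h, decide_true, if_true] at ha ⊢
        have := ih (hP.sublist List.eraseP_sublist) ha
        obtain ⟨x, l₁, l₂, h1, hx, h2, h3⟩ :=
          List.exists_of_eraseP (p := fun p => decide (p < bid b))
            (List.mem_of_getLast? hlast) (by simpa using h)
        have hc : (P.eraseP fun p => decide (p < bid b)).countP (fun p => decide (a ≤ p)) +
            (if decide (a < bid b) = true then 1 else 0) ≤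
              P.countP (fun p => decide (a ≤ p)) := by
          by_cases hab : a < bid b
          · have hax : a ≤ x := by
              rw [h2, List.mem_append, List.mem_cons] at haP
              rcases haP with h | h | h
              · exact absurd (by simpa using hab) (h1 a h)
              · exact h.le
              · rw [h2, List.pairwise_append, List.pairwise_cons] at hP
                exact hP.2.1.1 a h
            rw [h3]
            conv_rhs => rw [h2]
            simp only [List.countP_append, List.countP_cons, decide_eq_true_eq, hab, hax, if_true]
            omega
          · simpa [hab] using List.eraseP_sublist.countP_le
        simp only [List.countP_cons]
        omega
      · have hab : ¬a < bid b := fun h' => h (hpa.trans_lt h')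
        simp only [leftover, hlast, Exceeds, h, decide_false] at ha ⊢
        simpa [List.countP_cons, hab] using ih hP (by simpa using ha)

theorem not_lt_of_not_mem_rehearse (bid : β → α) (l : List β) {P : List α}
    (hP : P.Pairwise (· ≥ ·)) {b : β} (hb : b ∈ l)
    (hb' : b ∉ (rehearse (Exceeds bid) l P).map Prod.fst) :
    ∀ p ∈ leftover (Exceeds bid) l P, ¬p < bid b := by
  induction l generalizing P with
  | nil => simp at hb
  | cons b' l ih =>
    rcases hlast : P.getLast? with _ | p
    · rw [List.getLast?_eq_none_iff] at hlast
      simp [hlast, leftover_nil_right]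
    · by_cases h : p < bid b'
      · simp only [rehearse, leftover, hlast, Exceeds, h, decide_true, if_true, List.map_cons,
          List.mem_cons, not_or] at hb hb' ⊢
        exact ih (hP.sublist List.eraseP_sublist) (hb.resolve_left hb'.1) hb'.2
      · intro q hq
        simp only [rehearse, leftover, hlast, Exceeds, h, decide_false, Bool.false_eq_true,
          if_false] at hb' hq
        rcases List.mem_cons.1 hb with rfl | hb
        · exact fun hlt => h (lt_of_le_of_lt
            (getLast?_le_of_pairwise hP hlast ((leftover_sublist _ _ _).subset hq)) hlt)
        · exact ih hP hb hb' q hq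

theorem snd_mem_of_mem_rehearse (bid : β → α) (l : List β) {P : List α} {x : β × α}
    (hx : x ∈ rehearse (Exceeds bid) l P) : x.2 ∈ P ∧ x.2 < bid x.1 := by
  induction l generalizing P with
  | nil => simp [rehearse] at hx
  | cons b' l ih =>
    rcases hlast : P.getLast? with _ | p
    · simp [rehearse, hlast] at hx
    · by_cases h : p < bid b'
      · simp only [rehearse, hlast, Exceeds, h, decide_true, if_true, List.mem_cons] at hx
        rcases hx with rfl | hx
        · exact ⟨List.mem_of_getLast? hlast, h⟩
        · exact ⟨List.eraseP_subset (ih hx).1, (ih hx).2⟩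
      · simp only [rehearse, hlast, Exceeds, h, decide_false, Bool.false_eq_true, if_false] at hx
        exact ih hx

/-- The final thresholds `P'` that are at least `u` are bounded by the smallest of them, `a`: the
bids above `a` have all been approached, and so has a bid for each used threshold from `u` up
to `a`. -/
theorem exists_countP_le (bid : β → α) (l : List β) {P : List α}
    (hP : P.Pairwise (· ≥ ·)) (u : α) :
    P.countP (fun p => decide (u ≤ p)) ≤
        (rehearse (Exceeds bid) l P).countP (fun x => decide (u < bid x.1)) ∨
      ∃ a ∈ P, u ≤ a ∧
        P.countP (fun p => decide (u ≤ p)) + l.countP (fun b => decide (a < bid b)) ≤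
        (rehearse (Exceeds bid) l P).countP (fun x => decide (u < bid x.1)) +
          P.countP (fun p => decide (a ≤ p)) := by
  have h1 := countP_le_countP_rehearse_add bid l P u
  set P' := leftover (Exceeds bid) l P with hP'
  have hsorted : (P'.filter fun p => decide (u ≤ p)).Pairwise (· ≥ ·) :=
    hP.sublist (List.filter_sublist.trans (leftover_sublist _ _ _))
  rcases hlast : (P'.filter fun p => decide (u ≤ p)).getLast? with _ | a
  · left
    rw [List.getLast?_eq_none_iff] at hlast
    rw [List.countP_eq_length_filter (l := P'), hlast] at h1
    simpa using h1
  · right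
    have ha := List.mem_filter.1 (List.mem_of_getLast? hlast)
    have hua : u ≤ a := by simpa using ha.2
    have h2 := countP_add_countP_leftover_le bid l hP ha.1
    refine ⟨a, (leftover_sublist _ _ _).subset ha.1, hua, ?_⟩
    have h3 : P'.countP (fun p => decide (u ≤ p)) = P'.countP (fun p => decide (a ≤ p)) := by
      apply List.countP_congr
      intro p hp
      simp only [decide_eq_true_eq]
      refine ⟨fun hup => getLast?_le_of_pairwise hsorted hlast ?_, hua.trans⟩
      exact List.mem_filter.2 ⟨hp, by simpa using hup⟩
    rw [← hP'] at h2
    omega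

/-- The list of `k` thresholds made from a list of samples: its first `j` members, the last of
them being repeated. -/
def capped {τ : Type*} (k j : ℕ) (L : List τ) : List τ :=
  (List.range k).filterMap fun i => L[min i (j - 1)]?

variable {k j : ℕ} {L : List α}

theorem capped_eq_map {τ : Type*} {L : List τ} (hj : 1 ≤ j) (hjL : j ≤ L.length) :
    capped k j L = (List.range k).map fun i => L[min i (j - 1)]'(by omega) := by
  rw [capped, List.filterMap_eq_map_iff_forall_eq_some.2]
  intro i _
  rw [List.getElem?_eq_getElem]

theorem length_capped {τ : Type*} {L : List τ} (hj : 1 ≤ j) (hjL : j ≤ L.length) : (capped k j L).length = k := by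
  simp [capped_eq_map hj hjL]

theorem mem_of_mem_capped {τ : Type*} {L : List τ} {a : τ} (h : a ∈ capped k j L) : a ∈ L := by
  obtain ⟨i, -, hi⟩ := List.mem_filterMap.1 h
  exact List.mem_of_getElem? hi

theorem pairwise_capped (hj : 1 ≤ j) (hjL : j ≤ L.length) (hL : L.Pairwise (· ≥ ·)) :
    (capped k j L).Pairwise (· ≥ ·) := by
  rw [capped_eq_map hj hjL, List.pairwise_map]
  refine List.pairwise_lt_range.imp ?_
  intro a b hab
  rcases (min_le_min_right (j - 1) hab.le).lt_or_eq with h | h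
  · exact List.pairwise_iff_getElem.1 hL _ _ _ _ h
  · simp [h]

theorem le_getElem_iff_lt_countP (hL : L.Pairwise (· ≥ ·)) (u : α) {i : ℕ} (hi : i < L.length) :
    u ≤ L[i] ↔ i < L.countP (fun p => decide (u ≤ p)) := by
  induction L generalizing i with
  | nil => simp at hi
  | cons x L ih =>
    rw [List.pairwise_cons] at hL
    by_cases hx : u ≤ x
    · cases i with
      | zero => simp [hx]
      | succ i =>
        simp only [List.length_cons, Nat.add_lt_add_iff_right] at hi
        simp [hx, ih hL.2 hi]
    · have h0 : (x :: L).countP (fun p => decide (u ≤ p)) = 0 := by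
        rw [List.countP_eq_zero]
        intro y hy
        rw [decide_eq_true_eq]
        rcases List.mem_cons.1 hy with rfl | hy
        · exact hx
        · exact fun h => hx (h.trans (hL.1 y hy))
      rw [h0]
      simp only [not_lt_zero, iff_false]
      rcases List.mem_cons.1 (List.getElem_mem hi) with h | h
      · rwa [h]
      · exact fun h' => hx (h'.trans (hL.1 _ h))

theorem countP_range_lt (k N : ℕ) : (List.range k).countP (fun i => decide (i < N)) = min k N := by
  induction k with
  | zero => simp
  | succ k ih =>
    rw [List.range_succ, List.countP_append, ih]
    by_cases h : k < N
    · simp [h]; omega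
    · simp [h]; omega

theorem countP_capped (hj : 1 ≤ j) (hjk : j ≤ k) (hjL : j ≤ L.length)
    (hL : L.Pairwise (· ≥ ·)) (u : α) :
    (capped k j L).countP (fun p => decide (u ≤ p)) =
      if j ≤ L.countP (fun p => decide (u ≤ p)) then k
      else L.countP (fun p => decide (u ≤ p)) := by
  rw [capped_eq_map hj hjL, List.countP_map]
  set N := L.countP (fun p => decide (u ≤ p))
  have h1 : (List.range k).countP ((fun p => decide (u ≤ p)) ∘
      fun i => L[min i (j - 1)]'(by omega)) =
      (List.range k).countP (fun i => decide (min i (j - 1) < N)) := by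
    apply List.countP_congr
    intro i _
    simp only [Function.comp, decide_eq_true_eq]
    exact le_getElem_iff_lt_countP hL u _
  rw [h1]
  split_ifs with hN
  · have : (List.range k).countP (fun i => decide (min i (j - 1) < N)) =
        (List.range k).length := by
      rw [List.countP_eq_length]
      intro i _
      rw [decide_eq_true_eq]
      omega
    rw [this, List.length_range]
  · have : (List.range k).countP (fun i => decide (min i (j - 1) < N)) =
        (List.range k).countP (fun i => decide (i < N)) := by
      apply List.countP_congr
      intro i _
      simp only [decide_eq_true_eq]
      omega
    rw [this, countP_range_lt]
    omega

/-- Lower bound on the number of approached bids above `u`, in terms of the numbers of samples and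
bids above `u` and above some larger sample `a`. -/
theorem exists_min_countP_le (bid : β → α) (l : List β) (hj : 1 ≤ j) (hjk : j ≤ k)
    (hjL : j ≤ L.length) (hL : L.Pairwise (· ≥ ·)) (u : α) :
    min (L.countP fun p => decide (u ≤ p)) j ≤
        (rehearse (Exceeds bid) l (capped k j L)).countP (fun x => decide (u < bid x.1)) ∨
      ∃ a ∈ L, u ≤ a ∧
        min (L.countP fun p => decide (u ≤ p)) j + l.countP (fun b => decide (a < bid b)) ≤
        (rehearse (Exceeds bid) l (capped k j L)).countP (fun x => decide (u < bid x.1)) +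
          L.countP (fun p => decide (a ≤ p)) := by
  have hc := countP_capped hj hjk hjL hL
  rcases exists_countP_le bid l (pairwise_capped (k := k) hj hjL hL) u with h | ⟨a, ha, hua, h⟩
  · left
    refine le_trans ?_ h
    rw [hc]
    split_ifs <;> omega
  · right
    refine ⟨a, mem_of_mem_capped ha, hua, ?_⟩
    have hmono : L.countP (fun p => decide (a ≤ p)) ≤ L.countP (fun p => decide (u ≤ p)) := by
      apply List.countP_mono_left
      intro p _ hp
      simp only [decide_eq_true_eq] at hp ⊢
      exact hua.trans hp
    rw [hc, hc] at h
    split_ifs at h <;> omega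

/-- If a buyer is rejected whose bid is exceeded by `r < j` samples only, then almost all
thresholds have been used: at least `k - r` bids exceed every `u` with at least `j` samples
above. -/
theorem le_countP_add_of_not_mem_rehearse (bid : β → α) (l : List β) (hj : 1 ≤ j) (hjk : j ≤ k)
    (hjL : j ≤ L.length) (hL : L.Pairwise (· ≥ ·)) {b : β} (hb : b ∈ l)
    (hb' : b ∉ (rehearse (Exceeds bid) l (capped k j L)).map Prod.fst)
    (hbj : L.countP (fun p => decide (bid b ≤ p)) < j) {u : α}
    (hu : j ≤ L.countP fun p => decide (u ≤ p)) :
    k ≤ l.countP (fun b => decide (u < bid b)) + L.countP (fun p => decide (bid b ≤ p)) := by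
  have hc := countP_capped hj hjk hjL hL
  set R := rehearse (Exceeds bid) l (capped k j L) with hR
  set P' := leftover (Exceeds bid) l (capped k j L) with hP'
  have hlen : R.length + P'.length = k :=
    (length_rehearse_add_leftover _ _ _).trans (length_capped hj hjL)
  have h1 : P'.length ≤ L.countP (fun p => decide (bid b ≤ p)) := by
    have h2 : P'.countP (fun p => decide (bid b ≤ p)) = P'.length := by
      rw [List.countP_eq_length]
      intro p hp
      simpa using not_lt_of_not_mem_rehearse bid l (pairwise_capped hj hjL hL) hb hb' p hp
    have h3 := (leftover_sublist (Exceeds bid) l (capped k j L)).countP_le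
      (p := fun p => decide (bid b ≤ p))
    rw [← hP', h2, hc, if_neg (not_le.2 hbj)] at h3
    exact h3
  have h4 : R.length ≤ l.countP (fun b => decide (u < bid b)) := by
    have h5 : ∀ p ∈ capped k j L, u ≤ p := by
      have h6 := hc u
      rw [if_pos hu] at h6
      have h7 := h6.trans (length_capped (k := k) hj hjL).symm
      intro p hp
      simpa using List.countP_eq_length.1 h7 p hp
    have h8 : (R.map Prod.fst).countP (fun b => decide (u < bid b)) = (R.map Prod.fst).length := by
      rw [List.countP_eq_length]
      intro b hb
      obtain ⟨x, hx, rfl⟩ := List.mem_map.1 hb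
      have := snd_mem_of_mem_rehearse bid l hx
      simpa using (h5 _ this.1).trans_lt this.2
    rw [List.length_map] at h8
    rw [← h8]
    exact (map_fst_rehearse_sublist _ _ _).countP_le
  omega

end Greedy

/-! ### Random labelling of pairs by fair coins -/

section Walk

variable {n : ℕ}

/-- The two numbers of buyer `b` are called `(b, false)` and `(b, true)`, and the coin `ε b` says
which of them is her bid; the other one is her sample. The sign is `1` for bids and `-1` for
samples. -/
def sgn (ε : Fin n → Bool) (x : Fin n × Bool) : ℝ := if ε x.1 = x.2 then 1 else -1

/-- The sign at position `p` of an arrangement `e` of the `2 * n` numbers, and `0` for `p` out of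
range. -/
def step (e : Fin (2 * n) ≃ Fin n × Bool) (ε : Fin n → Bool) (p : ℕ) : ℝ :=
  if h : p < 2 * n then sgn ε (e ⟨p, h⟩) else 0

/-- The number of bids minus the number of samples at the first `l` positions. -/
def walk (e : Fin (2 * n) ≃ Fin n × Bool) (ε : Fin n → Bool) (l : ℕ) : ℝ :=
  ∑ p ∈ Finset.range l, step e ε p

theorem sgn_eq_or (ε : Fin n → Bool) (x : Fin n × Bool) : sgn ε x = 1 ∨ sgn ε x = -1 := by
  rw [sgn]
  split_ifs <;> simp

theorem sgn_mul_self (ε : Fin n → Bool) (x : Fin n × Bool) : sgn ε x * sgn ε x = 1 := by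
  rcases sgn_eq_or ε x with h | h <;> simp [h]

/-- Change all coins. -/
def flipAll (n : ℕ) : Equiv.Perm (Fin n → Bool) :=
  Function.Involutive.toPerm (fun ε b => !ε b) fun ε => by simp

/-- Change the coin of `b`. -/
def flipAt (b : Fin n) : Equiv.Perm (Fin n → Bool) :=
  Function.Involutive.toPerm (fun ε => Function.update ε b (!ε b)) fun ε => by simp

theorem sgn_flipAll (ε : Fin n → Bool) (x : Fin n × Bool) :
    sgn (flipAll n ε) x = -sgn ε x := by
  change (if (!ε x.1) = x.2 then (1 : ℝ) else -1) = -if ε x.1 = x.2 then 1 else -1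
  cases ε x.1 <;> cases x.2 <;> simp

theorem sgn_flipAt_self (ε : Fin n → Bool) (x : Fin n × Bool) :
    sgn (flipAt x.1 ε) x = -sgn ε x := by
  change (if Function.update ε x.1 (!ε x.1) x.1 = x.2 then (1 : ℝ) else -1) =
    -if ε x.1 = x.2 then 1 else -1
  rw [Function.update_self]
  cases ε x.1 <;> cases x.2 <;> simp

theorem sgn_flipAt_of_ne (ε : Fin n → Bool) {b : Fin n} {x : Fin n × Bool} (h : x.1 ≠ b) :
    sgn (flipAt b ε) x = sgn ε x := by
  change (if Function.update ε b (!ε b) x.1 = x.2 then (1 : ℝ) else -1) = _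
  rw [Function.update_of_ne h, sgn]

theorem expect_eq_zero_of_comp_eq_neg {f : (Fin n → Bool) → ℝ} (g : Equiv.Perm (Fin n → Bool))
    (h : ∀ ε, f (g ε) = -f ε) : 𝔼 ε, f ε = 0 := by
  have h1 : 𝔼 ε, f (g ε) = 𝔼 ε, f ε := Fintype.expect_equiv g _ _ fun _ => rfl
  simp only [h, Finset.expect_neg_distrib] at h1
  linarith

/-- The signs of different numbers are uncorrelated, except that those of the two numbers of a
buyer are opposite. -/
theorem expect_sgn_mul_sgn_nonpos {x y : Fin n × Bool} (h : x ≠ y) :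
    𝔼 ε, sgn ε x * sgn ε y ≤ 0 := by
  by_cases hb : y.1 = x.1
  · refine (Finset.expect_le_expect (g := fun _ => 0) fun ε _ => ?_).trans (by simp)
    have h2 : x.2 ≠ y.2 := fun h2 => h (Prod.ext hb.symm h2)
    simp only [sgn, hb]
    revert h2
    cases ε x.1 <;> cases x.2 <;> cases y.2 <;> simp
  · refine (expect_eq_zero_of_comp_eq_neg (flipAt x.1) fun ε => ?_).le
    rw [sgn_flipAt_self, sgn_flipAt_of_ne _ hb, neg_mul]

variable (e : Fin (2 * n) ≃ Fin n × Bool)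

theorem step_flipAll (ε : Fin n → Bool) (p : ℕ) : step e (flipAll n ε) p = -step e ε p := by
  rw [step, step]
  split_ifs
  · exact sgn_flipAll _ _
  · simp

theorem walk_flipAll (ε : Fin n → Bool) (l : ℕ) : walk e (flipAll n ε) l = -walk e ε l := by
  simp [walk, step_flipAll]

theorem expect_step (p : ℕ) : 𝔼 ε, step e ε p = 0 :=
  expect_eq_zero_of_comp_eq_neg (flipAll n) fun ε => step_flipAll e ε p

theorem expect_walk (l : ℕ) : 𝔼 ε, walk e ε l = 0 :=
  expect_eq_zero_of_comp_eq_neg (flipAll n) fun ε => walk_flipAll e ε l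

theorem expect_step_mul_walk_sq (p l : ℕ) : 𝔼 ε, step e ε p * walk e ε l ^ 2 = 0 :=
  expect_eq_zero_of_comp_eq_neg (flipAll n) fun ε => by
    rw [step_flipAll, walk_flipAll]
    ring

theorem expect_step_mul_step_le (p q : ℕ) :
    𝔼 ε, step e ε p * step e ε q ≤ if p = q then 1 else 0 := by
  by_cases hp : p < 2 * n
  · by_cases hq : q < 2 * n
    · simp only [step, hp, hq, dif_pos]
      split_ifs with h
      · subst h
        simp [sgn_mul_self]
      · refine expect_sgn_mul_sgn_nonpos ?_
        simpa using h
    · simp only [step, hq, dif_neg, not_false_eq_true, mul_zero, Finset.expect_const_zero]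
      split_ifs <;> simp
  · simp only [step, hp, dif_neg, not_false_eq_true, zero_mul, Finset.expect_const_zero]
    split_ifs <;> simp

theorem expect_step_mul_walk_le (p l : ℕ) : 𝔼 ε, step e ε p * walk e ε l ≤ 1 := by
  simp only [walk, Finset.mul_sum]
  rw [Finset.expect_sum_comm]
  refine (Finset.sum_le_sum fun q _ => expect_step_mul_step_le e p q).trans ?_
  rw [Finset.sum_ite_eq]
  split_ifs <;> simp

theorem expect_walk_sq_le (l : ℕ) : 𝔼 ε, walk e ε l ^ 2 ≤ l := by
  have h : ∀ ε, walk e ε l ^ 2 = ∑ p ∈ Finset.range l, step e ε p * walk e ε l := by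
    intro ε
    rw [← Finset.sum_mul, sq, ← walk]
  simp only [h]
  rw [Finset.expect_sum_comm]
  refine (Finset.sum_le_sum fun q _ => expect_step_mul_walk_le e q l).trans ?_
  simp

/-- Mean absolute value, by `2 * c * |D| ≤ D ^ 2 + c ^ 2`. -/
theorem expect_abs_walk_le (l : ℕ) {c : ℝ} (hc : 0 < c) :
    𝔼 ε, |walk e ε l| ≤ (l / c + c) / 2 := by
  have h : ∀ ε ∈ (Finset.univ : Finset (Fin n → Bool)),
      |walk e ε l| ≤ (1 / (2 * c)) * walk e ε l ^ 2 + c / 2 := by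
    intro ε _
    have h1 := sq_nonneg (|walk e ε l| - c)
    rw [sub_sq, sq_abs] at h1
    have h2 : (1 / (2 * c)) * walk e ε l ^ 2 + c / 2 - |walk e ε l| =
        (walk e ε l ^ 2 - 2 * |walk e ε l| * c + c ^ 2) / (2 * c) := by
      field_simp
      ring
    have h3 : 0 ≤ (walk e ε l ^ 2 - 2 * |walk e ε l| * c + c ^ 2) / (2 * c) := by positivity
    linarith
  refine (Finset.expect_le_expect h).trans ?_
  rw [Finset.expect_add_distrib, ← Finset.mul_expect, Fintype.expect_const]
  have := expect_walk_sq_le e l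
  have h4 : (1 / (2 * c)) * 𝔼 ε, walk e ε l ^ 2 ≤ (1 / (2 * c)) * l :=
    mul_le_mul_of_nonneg_left this (by positivity)
  refine (add_le_add_left h4 _).trans (le_of_eq ?_)
  field_simp

theorem abs_step_le (ε : Fin n → Bool) (p : ℕ) : |step e ε p| ≤ 1 := by
  rw [step]
  split_ifs with h
  · rcases sgn_eq_or ε (e ⟨p, h⟩) with h | h <;> simp [h]
  · simp

theorem abs_walk_sub_le (ε : Fin n → Bool) (a r : ℕ) :
    |walk e ε (a + r) - walk e ε a| ≤ r := by
  induction r with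
  | zero => simp
  | succ r ih =>
    have : walk e ε (a + (r + 1)) - walk e ε a =
        (walk e ε (a + r) - walk e ε a) + step e ε (a + r) := by
      rw [walk, ← add_assoc, Finset.sum_range_succ, ← walk]
      ring
    rw [this]
    refine (abs_add_le _ _).trans ?_
    push_cast
    exact add_le_add ih (abs_step_le e ε _)

/-- The values of the walk are controlled by those on a grid of width `g`. -/
theorem abs_walk_le_grid (ε : Fin n → Bool) {a g G : ℕ} (hg : 0 < g) (ha : a < G * g) :
    |walk e ε a| ≤ g + ∑ i ∈ Finset.range G, |walk e ε (g * i)| := by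
  have h1 := abs_walk_sub_le e ε (g * (a / g)) (a % g)
  rw [Nat.div_add_mod] at h1
  have h2 : |walk e ε (g * (a / g))| ≤ ∑ i ∈ Finset.range G, |walk e ε (g * i)| := by
    refine Finset.single_le_sum (f := fun i => |walk e ε (g * i)|) (fun i _ => abs_nonneg _) ?_
    rw [Finset.mem_range]
    exact Nat.div_lt_of_lt_mul (by rwa [mul_comm] at ha)
  have h3 : ((a % g : ℕ) : ℝ) ≤ g := by exact_mod_cast (Nat.mod_lt a hg).le
  have h4 := abs_sub_abs_le_abs_sub (walk e ε a) (walk e ε (g * (a / g)))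
  linarith

end Walk

/-! ### How many of the largest numbers are approached bids -/

section Counting

variable {n : ℕ} (e : Fin (2 * n) ≃ Fin n × Bool) {k j : ℕ} {acc : (Fin n → Bool) → ℕ → ℝ}

/-- Among the first `l` positions, for large `l`, more than a fraction of `0.27` are approached bids,
because the walk is small on the scale of `l`. Here `acc ε p` is the indicator of an approached bid
at position `p`, and in the hypothesis `(l - walk e ε l) / 2` is the number of samples among the
first `l` positions. -/
theorem expect_sum_acc_ge_of_large {l : ℕ} (hl : 100000 ≤ l) (hlk : l ≤ 2 * k)
    (hj : (0.99 : ℝ) * k ≤ j)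
    (ha : ∀ ε, ∃ a ≤ l, min ((l - walk e ε l) / 2) (j : ℝ) + walk e ε a ≤
      ∑ p ∈ Finset.range l, acc ε p) :
    (0.27 : ℝ) * l ≤ 𝔼 ε, ∑ p ∈ Finset.range l, acc ε p := by
  -- On a grid of 20 points a maximal inequality for the walk is not needed: the absolute values at
  -- the grid points are summed up, and the grid width `g` bounds the error in between.
  set g := l / 20 + 1 with hg
  have hL : (100000 : ℝ) ≤ l := by exact_mod_cast hl
  have hgl : (g : ℝ) ≤ l / 20 + 1 := by
    rw [hg]
    push_cast
    have : ((l / 20 : ℕ) : ℝ) ≤ l / 20 := by exact_mod_cast Nat.cast_div_le (α := ℝ)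
    linarith
  have hpoint : ∀ ε ∈ (Finset.univ : Finset (Fin n → Bool)),
      (0.495 * l - g : ℝ) - (1 / 2) * |walk e ε l| - ∑ i ∈ Finset.range 20, |walk e ε (g * i)| ≤
        ∑ p ∈ Finset.range l, acc ε p := by
    intro ε _
    obtain ⟨a, hal, h⟩ := ha ε
    refine le_trans ?_ h
    have h1 := abs_walk_le_grid e ε (a := a) (g := g) (G := 20) (by omega) (by omega)
    have h2 := neg_abs_le (walk e ε a)
    have h3 : 0.495 * l - (1 / 2) * |walk e ε l| ≤ min ((l - walk e ε l) / 2) (j : ℝ) := by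
      have h4 := le_abs_self (walk e ε l)
      have h5 := abs_nonneg (walk e ε l)
      have h6 : (l : ℝ) ≤ 2 * k := by exact_mod_cast hlk
      refine le_min ?_ ?_ <;> linarith
    linarith
  refine le_trans ?_ (Finset.expect_le_expect hpoint)
  rw [Finset.expect_sub_distrib, Finset.expect_sub_distrib, Fintype.expect_const,
    ← Finset.mul_expect, Finset.expect_sum_comm]
  have hc : (0 : ℝ) < l / 400 := by linarith
  have hD := expect_abs_walk_le e l hc
  have hG : ∀ i ∈ Finset.range 20, 𝔼 ε, |walk e ε (g * i)| ≤ 400 + (l / 400 : ℝ) / 2 := by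
    intro i hi
    refine (expect_abs_walk_le e (g * i) hc).trans ?_
    have h1 : g * i ≤ 2 * l := by
      have : i ≤ 20 := (Finset.mem_range.1 hi).le
      calc g * i ≤ g * 20 := Nat.mul_le_mul_left _ this
        _ ≤ 2 * l := by omega
    have h2 : ((g * i : ℕ) : ℝ) ≤ 2 * l := by exact_mod_cast h1
    have h3 : ((g * i : ℕ) : ℝ) / (l / 400) ≤ 800 := by
      rw [div_le_iff₀ hc]
      linarith
    linarith
  have hG' := Finset.sum_le_sum hG
  rw [Finset.sum_const, Finset.card_range, nsmul_eq_mul] at hG'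
  have hDl : (l : ℝ) / (l / 400) = 400 := by field_simp
  rw [hDl] at hD
  push_cast at hG'
  linarith

/-- One of the largest numbers is rarely a rejected bid: this needs an excess of bids over samples
that is a multiple of the standard deviation of the walk. In the hypothesis `hb`,
`(t - walk e ε t) / 2` and `(t + walk e ε t) / 2` are the numbers of samples and of bids among the
first `t` positions. -/
theorem expect_acc_ge_of_small {p l₀ s : ℕ} (hp : p < l₀) (hs : k = j + s)
    (hsk : 4 * k < (s + 1) ^ 2)
    (hs0 : 100 * l₀ ≤ s) (hlj : l₀ ≤ j) (hkn : k ≤ n)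
    (hacc : ∀ ε, 0 ≤ acc ε p)
    (hb : ∀ ε, 1 ≤ acc ε p ∨ step e ε p ≠ 1 ∨ ∀ t : ℕ, t ≤ 2 * n →
      (j : ℝ) ≤ (t - walk e ε t) / 2 → (k : ℝ) ≤ (t + walk e ε t) / 2 + p) :
    (0.27 : ℝ) ≤ 𝔼 ε, acc ε p := by
  obtain ⟨t, ht⟩ : ∃ t, t + l₀ = k + j := ⟨k + j - l₀, by omega⟩
  have htR : (t : ℝ) + l₀ = k + j := by exact_mod_cast ht
  have hsR : (k : ℝ) = j + s := by exact_mod_cast hs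
  have hpR : (p : ℝ) + 1 ≤ l₀ := by exact_mod_cast hp
  have hs0R : (100 : ℝ) * l₀ ≤ s := by exact_mod_cast hs0
  have hskR : (4 : ℝ) * k < (s + 1) ^ 2 := by exact_mod_cast hsk
  have hpos : (0 : ℝ) ≤ p := Nat.cast_nonneg p
  set u : ℝ := s / 2 with hu
  set w : ℝ := s - l₀ + u with hw
  have hw0 : 1.49 * (s : ℝ) ≤ w := by rw [hw, hu]; linarith
  have hwpos : 0 < w := by linarith
  -- One-sided Chebyshev inequality: a rejection forces the walk at `t` to be at least `w - u`, and
  -- the shift by `u` can be chosen freely; the mean square of the walk is at most about `s ^ 2 / 2`,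
  -- for which `u = s / 2` leads to the bound `1 / 3`.
  have hpoint : ∀ ε ∈ (Finset.univ : Finset (Fin n → Bool)),
      1 / 2 + (1 / 2) * step e ε p - (1 / (2 * w ^ 2)) * (walk e ε t ^ 2 + 2 * u * walk e ε t +
        u ^ 2 + step e ε p * walk e ε t ^ 2 + 2 * u * (step e ε p * walk e ε t) +
          u ^ 2 * step e ε p) ≤ acc ε p := by
    intro ε _
    have hfac : walk e ε t ^ 2 + 2 * u * walk e ε t +
        u ^ 2 + step e ε p * walk e ε t ^ 2 + 2 * u * (step e ε p * walk e ε t) +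
          u ^ 2 * step e ε p = (1 + step e ε p) * (walk e ε t + u) ^ 2 := by ring
    rw [hfac]
    have hX : step e ε p = 1 ∨ step e ε p = -1 := by
      rw [step, dif_pos (by omega)]
      exact sgn_eq_or _ _
    rcases hX with hX | hX
    · rw [hX]
      rcases hb ε with h | h | h
      · have : 0 ≤ (1 / (2 * w ^ 2)) * ((1 + 1) * (walk e ε t + u) ^ 2) := by positivity
        linarith
      · exact absurd hX h
      · have hbig : (s : ℝ) - l₀ ≤ walk e ε t := by
          by_contra hcon
          rw [not_le] at hcon
          have := h t (by omega) (by linarith)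
          linarith
        have h1 : w ^ 2 ≤ (walk e ε t + u) ^ 2 :=
          pow_le_pow_left₀ hwpos.le (by linarith) 2
        have h2 : 1 ≤ (1 / (2 * w ^ 2)) * ((1 + 1) * (walk e ε t + u) ^ 2) := by
          rw [div_mul_eq_mul_div, le_div_iff₀ (by positivity)]
          linarith
        have := hacc ε
        linarith
    · rw [hX]
      have := hacc ε
      simpa using this
  refine le_trans ?_ (Finset.expect_le_expect hpoint)
  simp only [Finset.expect_sub_distrib, Finset.expect_add_distrib, ← Finset.mul_expect,
    Fintype.expect_const, expect_step, expect_walk, expect_step_mul_walk_sq, mul_zero, add_zero]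
  have h1 := expect_walk_sq_le e t
  have h2 := expect_step_mul_walk_le e p t
  have h3 : 2 * u * 𝔼 ε, step e ε p * walk e ε t ≤ 2 * u * 1 :=
    mul_le_mul_of_nonneg_left h2 (by positivity)
  have h4 : (1 / (2 * w ^ 2)) * (𝔼 ε, walk e ε t ^ 2 + u ^ 2 +
      2 * u * 𝔼 ε, step e ε p * walk e ε t) ≤ 0.23 := by
    have hs100 : (100 : ℝ) ≤ s := by linarith
    have h5 : (1.49 * (s : ℝ)) ^ 2 ≤ w ^ 2 := pow_le_pow_left₀ (by positivity) hw0 2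
    rw [div_mul_eq_mul_div, div_le_iff₀ (by positivity)]
    have h6 : (100 : ℝ) * s ≤ s ^ 2 := by nlinarith
    have h7 : u ^ 2 = s ^ 2 / 4 := by rw [hu]; ring
    rw [h7]
    have h8 : (t : ℝ) ≤ (s + 1) ^ 2 / 2 := by
      have : (0 : ℝ) ≤ s := by positivity
      linarith
    nlinarith
  linarith

/-- The two largest numbers are a bid and a smaller sample with probability at least `1 / 4`. -/
theorem expect_acc_zero_ge (hn : 1 ≤ n) (hacc : ∀ ε, 0 ≤ acc ε 0)
    (h : ∀ ε, step e ε 0 = 1 → step e ε 1 = -1 → 1 ≤ acc ε 0) :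
    (1 / 4 : ℝ) ≤ 𝔼 ε, acc ε 0 := by
  have hpoint : ∀ ε ∈ (Finset.univ : Finset (Fin n → Bool)),
      1 / 4 + (1 / 4) * step e ε 0 - (1 / 4) * step e ε 1 -
        (1 / 4) * (step e ε 0 * step e ε 1) ≤ acc ε 0 := by
    intro ε _
    have h0 : step e ε 0 = 1 ∨ step e ε 0 = -1 := by
      rw [step, dif_pos (by omega)]
      exact sgn_eq_or _ _
    have h1 : step e ε 1 = 1 ∨ step e ε 1 = -1 := by
      rw [step, dif_pos (by omega)]
      exact sgn_eq_or _ _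
    have h2 := hacc ε
    have h3 := h ε
    rcases h0 with h0 | h0
    · rcases h1 with h1 | h1
      · rw [h0, h1]
        linarith
      · have := h3 h0 h1
        rw [h0, h1]
        linarith
    · rcases h1 with h1 | h1 <;> rw [h0, h1] <;> linarith
  refine le_trans ?_ (Finset.expect_le_expect hpoint)
  simp only [Finset.expect_sub_distrib, Finset.expect_add_distrib, ← Finset.mul_expect,
    Fintype.expect_const, expect_step, mul_zero, add_zero, sub_zero]
  have := expect_step_mul_step_le e 0 1
  simp only [zero_ne_one, if_false] at this
  linarith

/-- Abel summation: a comparison of all partial sums carries over to weighted sums with decreasing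
non-negative weights. -/
theorem sum_mul_le_sum_mul_of_partial_sums {N : ℕ} {w a b : ℕ → ℝ} (hw : ∀ i, w (i + 1) ≤ w i)
    (hw0 : ∀ i, 0 ≤ w i)
    (h : ∀ l ≤ N, ∑ p ∈ Finset.range l, a p ≤ ∑ p ∈ Finset.range l, b p) :
    ∑ p ∈ Finset.range N, w p * a p ≤ ∑ p ∈ Finset.range N, w p * b p := by
  suffices H : ∀ l ≤ N, w l * (∑ p ∈ Finset.range l, b p - ∑ p ∈ Finset.range l, a p) ≤
      ∑ p ∈ Finset.range l, w p * b p - ∑ p ∈ Finset.range l, w p * a p by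
    have h1 := H N le_rfl
    have h2 := mul_nonneg (hw0 N) (sub_nonneg.2 (h N le_rfl))
    linarith
  intro l
  induction l with
  | zero => simp
  | succ l ih =>
    intro hl
    have h1 := ih (by omega)
    have h2 := h (l + 1) hl
    have h3 := mul_le_mul_of_nonneg_right (hw l) (sub_nonneg.2 h2)
    simp only [Finset.sum_range_succ] at h3 ⊢
    linarith

end Counting

/-! ### The approached buyers against the best `k` buyers -/

/-- The largest total value of at most `k` buyers. -/
noncomputable def topSum {n : ℕ} (k : ℕ) (v : Fin n → ℝ≥0) : ℝ≥0 :=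
  (Finset.univ.filter fun B : Finset (Fin n) => B.card ≤ k).sup fun B => ∑ b ∈ B, v b

theorem sum_le_topSum {n k : ℕ} (v : Fin n → ℝ≥0) {B : Finset (Fin n)} (hB : B.card ≤ k) :
    ∑ b ∈ B, v b ≤ topSum k v :=
  Finset.le_sup (f := fun B => ∑ b ∈ B, v b) (by simpa using hB)

theorem topSum_le_of_forall {n k : ℕ} (v : Fin n → ℝ≥0) {x : ℝ≥0}
    (h : ∀ B : Finset (Fin n), B.card ≤ k → ∑ b ∈ B, v b ≤ x) : topSum k v ≤ x :=
  Finset.sup_le fun B hB => h B (by simpa using hB)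

/-- The price `t` per buyer, plus all that buyers have on top of `t`. -/
theorem topSum_le_mul_add {n : ℕ} (k : ℕ) (v : Fin n → ℝ≥0) (t : ℝ≥0) :
    topSum k v ≤ k * t + ∑ b, (v b - t) := by
  refine topSum_le_of_forall v fun B hB => ?_
  calc ∑ b ∈ B, v b ≤ ∑ b ∈ B, (t + (v b - t)) :=
        Finset.sum_le_sum fun b _ => le_add_tsub
    _ = B.card * t + ∑ b ∈ B, (v b - t) := by
        rw [Finset.sum_add_distrib, Finset.sum_const, nsmul_eq_mul]
    _ ≤ k * t + ∑ b, (v b - t) := by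
        gcongr
        exact Finset.subset_univ B

section Positions

variable {α : Type*} [LinearOrder α] {n : ℕ}

/-- An arrangement of the numbers in decreasing order. -/
theorem exists_arrangement {y : Fin n × Bool → α} (hy : Function.Injective y) :
    ∃ e : Fin (2 * n) ≃ Fin n × Bool, ∀ p q, y (e p) < y (e q) ↔ q < p := by
  let _ : LinearOrder (Fin n × Bool) :=
    LinearOrder.lift' (fun x => OrderDual.toDual (y x)) fun _ _ h =>
      hy (OrderDual.toDual.injective h)
  let f := Fintype.orderIsoFinOfCardEq (Fin n × Bool)
    (by rw [Fintype.card_prod, Fintype.card_fin, Fintype.card_bool, mul_comm])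
  have h : ∀ p q, y (f q) ≤ y (f p) ↔ p ≤ q := fun p q => f.map_rel_iff'
  refine ⟨f.toEquiv, fun p q => ?_⟩
  rw [← not_le, ← not_le, not_iff_not]
  exact h p q

/-- Sums over bids as weighted sums over all numbers, the weight being the indicator of bids. -/
theorem sum_bids (ε : Fin n → Bool) (f : Fin n × Bool → ℝ) :
    ∑ b, f (b, ε b) = ∑ x, f x * ((1 + sgn ε x) / 2) := by
  rw [Fintype.sum_prod_type]
  refine Finset.sum_congr rfl fun b _ => ?_
  rw [Fintype.sum_bool]
  cases h : ε b <;> simp [sgn, h]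

/-- Sums over samples as weighted sums over all numbers, the weight being the indicator of
samples. -/
theorem sum_samples (ε : Fin n → Bool) (f : Fin n × Bool → ℝ) :
    ∑ b, f (b, !ε b) = ∑ x, f x * ((1 - sgn ε x) / 2) := by
  rw [Fintype.sum_prod_type]
  refine Finset.sum_congr rfl fun b _ => ?_
  rw [Fintype.sum_bool]
  cases h : ε b <;> simp [sgn, h]

theorem sum_fin_lt_eq {N q : ℕ} (hq : q ≤ N) (f : Fin N → ℝ) (F : ℕ → ℝ)
    (h : ∀ p : Fin N, f p = if (p : ℕ) < q then F p else 0) :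
    ∑ p, f p = ∑ p ∈ Finset.range q, F p := by
  simp only [h]
  rw [Fin.sum_univ_eq_sum_range (fun p => if p < q then F p else 0) N, ← Finset.sum_filter]
  congr 1
  ext p
  simp only [Finset.mem_filter, Finset.mem_range]
  omega

theorem countP_ofFn_perm (σ : Equiv.Perm (Fin n)) (p : Fin n → Bool) :
    ((List.ofFn σ).countP p : ℝ) = ∑ b, if p b then (1 : ℝ) else 0 := by
  rw [List.countP_eq_length_filter, ← List.toFinset_card_of_nodup
    ((nodup_ofFn_perm σ).filter _), ← Finset.sum_filter, Finset.sum_const, nsmul_eq_mul, mul_one]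
  congr 2
  ext b
  have : ∃ a, σ a = b := σ.surjective b
  simp [List.mem_ofFn, this]

theorem countP_perm_ofFn {γ : Type*} {L : List γ} {f : Fin n → γ} (hL : L.Perm (List.ofFn f))
    (p : γ → Bool) : (L.countP p : ℝ) = ∑ b, if p (f b) then (1 : ℝ) else 0 := by
  have h := countP_ofFn_perm (1 : Equiv.Perm (Fin n)) (p ∘ f)
  rw [hL.countP_eq, ← show (List.ofFn (1 : Equiv.Perm (Fin n))).map f = List.ofFn f by
    rw [List.map_ofFn]; rfl, List.countP_map, h]
  rfl

variable {y : Fin n × Bool → α} {e : Fin (2 * n) ≃ Fin n × Bool}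

theorem step_coe (ε : Fin n → Bool) (p : Fin (2 * n)) : step e ε p = sgn ε (e p) := by
  rw [step, dif_pos p.2]

theorem countP_bids (he : ∀ p q, y (e p) < y (e q) ↔ q < p) (ε : Fin n → Bool)
    (σ : Equiv.Perm (Fin n)) (q : Fin (2 * n)) :
    ((List.ofFn σ).countP (fun b => decide (y (e q) < y (b, ε b))) : ℝ) =
      (q + walk e ε q) / 2 := by
  rw [countP_ofFn_perm, sum_bids ε fun x => if decide (y (e q) < y x) = true then (1 : ℝ) else 0,
    ← e.sum_comp, sum_fin_lt_eq q.2.le _ (fun p => (1 + step e ε p) / 2)]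
  · rw [← Finset.sum_div, Finset.sum_add_distrib, walk]
    simp
  · intro p
    simp only [decide_eq_true_eq, he, step_coe, Fin.lt_def]
    split_ifs <;> simp

theorem countP_samples (he : ∀ p q, y (e p) < y (e q) ↔ q < p) (ε : Fin n → Bool)
    {L : List α} (hL : L.Perm (List.ofFn fun b => y (b, !ε b))) (q : Fin (2 * n)) :
    (L.countP (fun p => decide (y (e q) ≤ p)) : ℝ) =
      ((q + 1 : ℕ) - walk e ε (q + 1)) / 2 := by
  rw [countP_perm_ofFn hL,
    sum_samples ε fun x => if decide (y (e q) ≤ y x) = true then (1 : ℝ) else 0,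
    ← e.sum_comp, sum_fin_lt_eq (q := q + 1) q.2 _ (fun p => (1 - step e ε p) / 2)]
  · rw [← Finset.sum_div, Finset.sum_sub_distrib, walk]
    simp
  · intro p
    have : y (e q) ≤ y (e p) ↔ (p : ℕ) < q + 1 := by
      rw [← not_lt, he, Fin.lt_def]
      omega
    simp only [decide_eq_true_eq, this, step_coe]
    split_ifs <;> simp

/-- The indicator of the event that position `p` of the arrangement is the bid of a buyer in `B`. -/
noncomputable def indicatorBid (e : Fin (2 * n) ≃ Fin n × Bool) (B : Finset (Fin n))
    (ε : Fin n → Bool) (p : ℕ) : ℝ :=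
  if h : p < 2 * n then (if (e ⟨p, h⟩).1 ∈ B then (1 + step e ε p) / 2 else 0) else 0

theorem indicatorBid_nonneg (B : Finset (Fin n)) (ε : Fin n → Bool) (p : ℕ) :
    0 ≤ indicatorBid e B ε p := by
  rw [indicatorBid]
  split_ifs
  · have := neg_le_of_abs_le (abs_step_le e ε p)
    linarith
  · exact le_rfl
  · exact le_rfl

theorem sum_bids_mem (he : ∀ p q, y (e p) < y (e q) ↔ q < p) (ε : Fin n → Bool)
    (B : Finset (Fin n)) (q : Fin (2 * n)) :
    (∑ b, if b ∈ B ∧ y (e q) < y (b, ε b) then (1 : ℝ) else 0) =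
      ∑ p ∈ Finset.range q, indicatorBid e B ε p := by
  rw [sum_bids ε fun x => if x.1 ∈ B ∧ y (e q) < y x then (1 : ℝ) else 0,
    ← e.sum_comp, sum_fin_lt_eq q.2.le _ (indicatorBid e B ε)]
  intro p
  simp only [he, indicatorBid, p.2, dif_pos, step_coe, Fin.lt_def, Fin.eta]
  by_cases h1 : (e p).1 ∈ B <;> by_cases h2 : (p : ℕ) < q <;> simp [h1, h2]

/-- The values in decreasing order. -/
noncomputable def weight {γ : Type*} (y : Fin n × Bool → γ) (e : Fin (2 * n) ≃ Fin n × Bool)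
    (val : γ → ℝ≥0) (p : ℕ) : ℝ :=
  if h : p < 2 * n then (val (y (e ⟨p, h⟩)) : ℝ) else 0

theorem weight_nonneg {γ : Type*} {y : Fin n × Bool → γ} (val : γ → ℝ≥0) (p : ℕ) : 0 ≤ weight y e val p := by
  rw [weight]
  split_ifs <;> simp

theorem weight_antitone (he : ∀ p q, y (e p) < y (e q) ↔ q < p) {val : α → ℝ≥0}
    (hval : Monotone val) : Antitone (weight y e val) := by
  intro p q hpq
  by_cases hq : q < 2 * n
  · have hp : p < 2 * n := hpq.trans_lt hq
    rw [weight, weight, dif_pos hp, dif_pos hq]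
    refine NNReal.coe_le_coe.2 (hval ?_)
    rw [← not_lt, he]
    simpa using hpq
  · rw [weight, dif_neg hq]
    exact weight_nonneg val p

theorem sum_values_eq {γ : Type*} {y : Fin n × Bool → γ} (val : γ → ℝ≥0) (ε : Fin n → Bool) (B : Finset (Fin n)) :
    ∑ b ∈ B, (val (y (b, ε b)) : ℝ) =
      ∑ p ∈ Finset.range (2 * n), weight y e val p * indicatorBid e B ε p := by
  have h0 : ∑ b ∈ B, (val (y (b, ε b)) : ℝ) =
      ∑ b, if b ∈ B then (val (y (b, ε b)) : ℝ) else 0 := by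
    rw [Finset.sum_ite_mem, Finset.univ_inter]
  rw [h0, sum_bids ε fun x => if x.1 ∈ B then (val (y x) : ℝ) else 0, ← e.sum_comp,
    sum_fin_lt_eq le_rfl]
  intro p
  simp only [weight, indicatorBid, p.2, dif_pos, if_true, step_coe, Fin.eta]
  split_ifs <;> simp

/-- The best `k` of the bids are on average worth at most half of the `2 * k` largest numbers. -/
theorem expect_topSum_le (he : ∀ p q, y (e p) < y (e q) ↔ q < p) {val : α → ℝ≥0}
    (hval : Monotone val) {k : ℕ} (hk : 0 < k) (hkn : k ≤ n) :
    𝔼 ε : Fin n → Bool, (topSum k (fun b => val (y (b, ε b))) : ℝ) ≤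
      (1 / 2) * ∑ p ∈ Finset.range (2 * k), weight y e val p := by
  -- The price is the smallest of the `2 * k` largest numbers.
  have hlast : 2 * k - 1 < 2 * n := by omega
  set t : ℝ≥0 := val (y (e ⟨2 * k - 1, hlast⟩)) with ht
  have htw : (t : ℝ) = weight y e val (2 * k - 1) := by rw [weight, dif_pos hlast]
  set f : Fin n × Bool → ℝ := fun x => ((val (y x) - t : ℝ≥0) : ℝ) with hf
  have h1 : ∀ ε ∈ (Finset.univ : Finset (Fin n → Bool)),
      (topSum k (fun b => val (y (b, ε b))) : ℝ) ≤
        k * t + ∑ x, f x * (1 / 2) + ∑ x, f x * (1 / 2) * sgn ε x := by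
    intro ε _
    have h2 : (topSum k (fun b => val (y (b, ε b))) : ℝ) ≤ k * t + ∑ b, f (b, ε b) := by
      have := NNReal.coe_le_coe.2 (topSum_le_mul_add k (fun b => val (y (b, ε b))) t)
      push_cast at this
      exact this
    refine h2.trans (le_of_eq ?_)
    rw [sum_bids ε f, add_assoc, ← Finset.sum_add_distrib]
    congr 1
    exact Finset.sum_congr rfl fun x _ => by ring
  refine (Finset.expect_le_expect h1).trans ?_
  rw [Finset.expect_add_distrib, Fintype.expect_const, Finset.expect_sum_comm]
  have h3 : ∀ x ∈ (Finset.univ : Finset (Fin n × Bool)), 𝔼 ε, f x * (1 / 2) * sgn ε x = 0 := by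
    intro x _
    rw [← Finset.mul_expect, expect_eq_zero_of_comp_eq_neg (flipAll n) fun ε => sgn_flipAll ε x,
      mul_zero]
  rw [Finset.sum_congr rfl h3, Finset.sum_const_zero, add_zero, ← e.sum_comp,
    sum_fin_lt_eq (q := 2 * k) (by omega) _ (fun p => (weight y e val p - t) * (1 / 2))]
  · rw [← Finset.sum_mul, Finset.sum_sub_distrib, Finset.sum_const, Finset.card_range,
      nsmul_eq_mul]
    push_cast
    exact le_of_eq (by ring)
  · intro p
    have hw : weight y e val p = val (y (e p)) := by rw [weight, dif_pos p.2]
    have hanti := weight_antitone (e := e) he hval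
    split_ifs with hp
    · have : t ≤ val (y (e p)) := by
        rw [← NNReal.coe_le_coe, htw, ← hw]
        exact hanti (by omega)
      simp only [hf, hw, NNReal.coe_sub this]
    · have : val (y (e p)) ≤ t := by
        rw [← NNReal.coe_le_coe, htw, ← hw]
        exact hanti (by omega)
      simp only [hf, tsub_eq_zero_of_le this, NNReal.coe_zero, zero_mul]

theorem topSum_le_mul_weight_zero (he : ∀ p q, y (e p) < y (e q) ↔ q < p) {val : α → ℝ≥0}
    (hval : Monotone val) (k : ℕ) (ε : Fin n → Bool) :
    (topSum k (fun b => val (y (b, ε b))) : ℝ) ≤ k * weight y e val 0 := by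
  have h0 := weight_nonneg (e := e) (y := y) val 0
  obtain ⟨W, hW⟩ : ∃ W : ℝ≥0, (W : ℝ) = weight y e val 0 := ⟨_, Real.coe_toNNReal _ h0⟩
  rw [← hW]
  have h : topSum k (fun b => val (y (b, ε b))) ≤ k * W := by
    refine topSum_le_of_forall _ fun B hB => ?_
    calc ∑ b ∈ B, val (y (b, ε b)) ≤ ∑ b ∈ B, W := by
          refine Finset.sum_le_sum fun b _ => ?_
          rw [← NNReal.coe_le_coe, hW]
          have h1 : ((val (y (b, ε b)) : ℝ≥0) : ℝ) = weight y e val (e.symm (b, ε b)) := by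
            rw [weight, dif_pos (e.symm (b, ε b)).2]
            simp
          rw [h1]
          exact weight_antitone he hval (Nat.zero_le _)
      _ = B.card * W := by rw [Finset.sum_const, nsmul_eq_mul]
      _ ≤ k * W := by gcongr
  exact_mod_cast h

variable {k j : ℕ} {L : (Fin n → Bool) → List α}

/-- The buyers who are approached when the coins `ε` say which numbers are bids and `P` is the list
of thresholds. -/
noncomputable def approachedSet (y : Fin n × Bool → α) (σ : Equiv.Perm (Fin n)) (P : List α)
    (ε : Fin n → Bool) : Finset (Fin n) :=
  ((rehearse (Exceeds fun b => y (b, ε b)) (List.ofFn σ) P).map Prod.fst).toFinset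

theorem countP_rehearse_eq (he : ∀ p q, y (e p) < y (e q) ↔ q < p) (σ : Equiv.Perm (Fin n))
    (P : List α) (ε : Fin n → Bool) (q : Fin (2 * n)) :
    ((rehearse (Exceeds fun b => y (b, ε b)) (List.ofFn σ) P).countP
      (fun x => decide (y (e q) < y (x.1, ε x.1))) : ℝ) =
      ∑ p ∈ Finset.range q, indicatorBid e (approachedSet y σ P ε) ε p := by
  set R := rehearse (Exceeds fun b => y (b, ε b)) (List.ofFn σ) P with hR
  have hnd : (R.map Prod.fst).Nodup := (map_fst_rehearse_sublist _ _ _).nodup (nodup_ofFn_perm σ)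
  have h1 : R.countP (fun x => decide (y (e q) < y (x.1, ε x.1))) =
      (R.map Prod.fst).countP fun b => decide (y (e q) < y (b, ε b)) := by
    rw [List.countP_map]
    rfl
  rw [h1, List.countP_eq_length_filter, ← List.toFinset_card_of_nodup (hnd.filter _),
    ← sum_bids_mem he, ← Finset.sum_filter, Finset.sum_const, nsmul_eq_mul, mul_one]
  congr 2
  ext b
  simp only [List.mem_toFinset, List.mem_filter, Finset.mem_filter, Finset.mem_univ, true_and,
    decide_eq_true_eq, approachedSet, hR]

/-- A lower bound on the number of approached bids among the first `l` positions: the number of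
samples there, capped at `j`, minus the deepest descent of the walk. -/
theorem exists_min_add_walk_le (he : ∀ p q, y (e p) < y (e q) ↔ q < p) (σ : Equiv.Perm (Fin n))
    (hj : 1 ≤ j) (hjk : j ≤ k) (hkn : k ≤ n) (ε : Fin n → Bool) {L : List α}
    (hL : L.Perm (List.ofFn fun b => y (b, !ε b))) (hsort : L.Pairwise (· ≥ ·))
    {l : ℕ} (hl : l ≤ 2 * n) :
    ∃ a ≤ l, min ((l - walk e ε l) / 2) (j : ℝ) + walk e ε a ≤
      ∑ p ∈ Finset.range l, indicatorBid e (approachedSet y σ (capped k j L) ε) ε p := by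
  have hlen : L.length = n := by simpa using hL.length_eq
  rcases l with _ | q
  · exact ⟨0, le_rfl, by simp [walk]⟩
  · have hmono : ∑ p ∈ Finset.range q,
        indicatorBid e (approachedSet y σ (capped k j L) ε) ε p ≤
        ∑ p ∈ Finset.range (q + 1),
          indicatorBid e (approachedSet y σ (capped k j L) ε) ε p := by
      rw [Finset.sum_range_succ]
      have := indicatorBid_nonneg (e := e) (approachedSet y σ (capped k j L) ε) ε q
      linarith
    have hA := countP_rehearse_eq he σ (capped k j L) ε ⟨q, hl⟩
    have hS := countP_samples he ε hL ⟨q, hl⟩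
    simp only at hA hS
    rcases exists_min_countP_le (fun b => y (b, ε b)) (List.ofFn σ) hj hjk (by omega) hsort
      (y (e ⟨q, hl⟩)) with h | ⟨a, haL, hua, h⟩
    · refine ⟨0, Nat.zero_le _, ?_⟩
      rw [← Nat.cast_le (α := ℝ), Nat.cast_min, hS, hA] at h
      simp only [walk, Finset.range_zero, Finset.sum_empty, add_zero] at h ⊢
      exact h.trans hmono
    · obtain ⟨b, hb⟩ := List.mem_ofFn.1 (hL.mem_iff.1 haL)
      obtain ⟨q', hq'⟩ := e.surjective (b, !ε b)
      rw [← hq'] at hb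
      subst hb
      have hqq : (q' : ℕ) ≤ q := by
        rw [← not_lt, he] at hua
        simpa [Fin.lt_def] using hua
      have hstep : step e ε q' = -1 := by
        rw [step_coe, hq', sgn]
        simp
      refine ⟨q' + 1, by omega, ?_⟩
      rw [← Nat.cast_le (α := ℝ), Nat.cast_add, Nat.cast_add, Nat.cast_min, hS, hA,
        countP_bids he, countP_samples he ε hL] at h
      have hw : walk e ε (q' + 1) = walk e ε q' - 1 := by
        rw [walk, Finset.sum_range_succ, hstep, ← walk]
        ring
      rw [hw] at h ⊢
      push_cast at h hmono ⊢
      linarith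

/-- If position `p < j` is a rejected bid, then at least `k - p` bids exceed every number that at
least `j` samples exceed. -/
theorem rejected_imp (he : ∀ p q, y (e p) < y (e q) ↔ q < p) (σ : Equiv.Perm (Fin n))
    (hj : 1 ≤ j) (hjk : j ≤ k) (hkn : k ≤ n) (ε : Fin n → Bool) {L : List α}
    (hL : L.Perm (List.ofFn fun b => y (b, !ε b))) (hsort : L.Pairwise (· ≥ ·))
    {p : ℕ} (hp : p < j) :
    1 ≤ indicatorBid e (approachedSet y σ (capped k j L) ε) ε p ∨ step e ε p ≠ 1 ∨
      ∀ t : ℕ, t ≤ 2 * n → (j : ℝ) ≤ (t - walk e ε t) / 2 →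
        (k : ℝ) ≤ (t + walk e ε t) / 2 + p := by
  have hlen : L.length = n := by simpa using hL.length_eq
  have hp2 : p < 2 * n := by omega
  by_cases hX : step e ε p = 1
  swap
  · exact Or.inr (Or.inl hX)
  set b := (e ⟨p, hp2⟩).1 with hb
  have hbid : (b, ε b) = e ⟨p, hp2⟩ := by
    rw [step, dif_pos hp2, sgn] at hX
    split_ifs at hX with h
    · exact Prod.ext rfl h
    · norm_num at hX
  by_cases hmem : b ∈ approachedSet y σ (capped k j L) ε
  · left
    rw [indicatorBid, dif_pos hp2, if_pos hmem, hX]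
    norm_num
  right
  right
  intro t ht hjt
  rcases t with _ | q
  · simp only [walk, Finset.range_zero, Finset.sum_empty, Nat.cast_zero, sub_zero, zero_div]
      at hjt
    have : j ≤ 0 := by exact_mod_cast hjt
    omega
  have hcount : (L.countP (fun x => decide (y (b, ε b) ≤ x)) : ℝ) = (p - walk e ε p) / 2 := by
    rw [hbid, countP_samples he ε hL ⟨p, hp2⟩]
    simp only
    rw [walk, Finset.sum_range_succ, hX, ← walk]
    push_cast
    ring
  have hwp := abs_walk_sub_le e ε 0 p
  have hw0 : walk e ε 0 = 0 := by simp [walk]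
  rw [hw0, sub_zero, zero_add] at hwp
  have hle : (L.countP (fun x => decide (y (b, ε b) ≤ x)) : ℝ) ≤ p := by
    rw [hcount]
    have := neg_le_of_abs_le hwp
    linarith
  have hle' : L.countP (fun x => decide (y (b, ε b) ≤ x)) ≤ p := by exact_mod_cast hle
  have hS := countP_samples he ε hL ⟨q, ht⟩
  simp only at hS
  rw [← hS] at hjt
  have h := le_countP_add_of_not_mem_rehearse (fun b => y (b, ε b)) (List.ofFn σ) hj hjk
    (by omega) hsort (b := b) (List.mem_ofFn.2 (σ.surjective b))
    (by simpa [approachedSet] using hmem) (by omega) (u := y (e ⟨q, ht⟩))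
    (by exact_mod_cast hjt)
  have h2 : (k : ℝ) ≤ ((List.ofFn σ).countP
      (fun b => decide (y (e ⟨q, ht⟩) < y (b, ε b))) : ℝ) + p := by
    exact_mod_cast h.trans (Nat.add_le_add_left hle' _)
  rw [countP_bids he] at h2
  have hstep := neg_le_of_abs_le (abs_step_le e ε q)
  have hw : walk e ε (q + 1) = walk e ε q + step e ε q := by
    rw [walk, Finset.sum_range_succ, ← walk]
  rw [hw]
  push_cast at h2 ⊢
  linarith

/-- From this `k` on, the estimates for large `k` apply. It is chosen such that `√(4 * k)` is at
least `100` times the bound `100000` on the positions that are treated one by one. -/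
def largeK : ℕ := 10 ^ 14

theorem numTop_le {k : ℕ} (hk : 0 < k) : numTop k ≤ k := max_le hk (Nat.sub_le _ _)

/-- The approached buyers have a positive fraction of the value of the best `k` buyers, and more
than `27 / 50` of it for large `k`. -/
theorem expect_topSum_le_mul (hy : Function.Injective y) {val : α → ℝ≥0} (hval : Monotone val)
    (σ : Equiv.Perm (Fin n)) {k : ℕ} (hk : 0 < k) (hkn : k ≤ n)
    (hL : ∀ ε, (L ε).Perm (List.ofFn fun b => y (b, !ε b))) (hsort : ∀ ε, (L ε).Pairwise (· ≥ ·)) :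
    𝔼 ε : Fin n → Bool, (topSum k (fun b => val (y (b, ε b))) : ℝ) ≤
      (if largeK ≤ k then 50 / 27 else 4 * k : ℝ) *
        𝔼 ε, ∑ b ∈ approachedSet y σ (capped k (numTop k) (L ε)) ε, (val (y (b, ε b)) : ℝ) := by
  obtain ⟨e, he⟩ := exists_arrangement hy
  set j := numTop k with hj
  have hj1 : 1 ≤ j := le_max_left _ _
  have hjk : j ≤ k := numTop_le hk
  set acc : (Fin n → Bool) → ℕ → ℝ := fun ε p =>
    indicatorBid e (approachedSet y σ (capped k j (L ε)) ε) ε p with hacc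
  have hacc0 : ∀ ε p, 0 ≤ acc ε p := fun ε p => indicatorBid_nonneg _ _ _
  have hw0 := weight_nonneg (y := y) (e := e) val
  have hH : 𝔼 ε, ∑ b ∈ approachedSet y σ (capped k j (L ε)) ε, (val (y (b, ε b)) : ℝ) =
      ∑ p ∈ Finset.range (2 * n), weight y e val p * 𝔼 ε, acc ε p := by
    simp only [sum_values_eq (e := e), Finset.mul_expect]
    rw [Finset.expect_sum_comm]
  have hE0 : ∀ p, 0 ≤ 𝔼 ε, acc ε p := fun p => Finset.expect_nonneg fun ε _ => hacc0 ε p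
  have ha : ∀ ε, ∀ l ≤ 2 * n, ∃ a ≤ l, min ((l - walk e ε l) / 2) (j : ℝ) + walk e ε a ≤
      ∑ p ∈ Finset.range l, acc ε p := fun ε l hl =>
    exists_min_add_walk_le he σ hj1 hjk hkn ε (hL ε) (hsort ε) hl
  rw [hH]
  split_ifs with hlarge
  · rw [largeK] at hlarge
    set s := Nat.sqrt (4 * k) with hs
    have hsq : s * s ≤ 4 * k := Nat.sqrt_le _
    have hsq' : 4 * k < (s + 1) * (s + 1) := Nat.lt_succ_sqrt _
    have hs7 : 10 ^ 7 ≤ s := by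
      by_contra hcon
      have : s + 1 ≤ 10 ^ 7 := by omega
      have := Nat.mul_le_mul this this
      omega
    have hs100 : 100 * s ≤ k := by nlinarith
    have hkj : k = j + s := by
      have : j = k - s := max_eq_right (by omega)
      omega
    have hpartial : ∀ l ≤ 2 * k, ∑ p ∈ Finset.range l, (27 / 100 : ℝ) ≤
        ∑ p ∈ Finset.range l, 𝔼 ε, acc ε p := by
      intro l hl
      by_cases hlbig : 100000 ≤ l
      · rw [Finset.sum_const, Finset.card_range, nsmul_eq_mul, ← Finset.expect_sum_comm]
        have h99 : (0.99 : ℝ) * k ≤ j := by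
          have h1 : (k : ℝ) = j + s := by exact_mod_cast hkj
          have h2 : (100 : ℝ) * s ≤ k := by exact_mod_cast hs100
          linarith
        have := expect_sum_acc_ge_of_large e hlbig hl h99 fun ε => ha ε l (by omega)
        linarith
      · refine Finset.sum_le_sum fun p hp => ?_
        rw [Finset.mem_range] at hp
        have := expect_acc_ge_of_small e (acc := acc) (p := p) (l₀ := 100000) (by omega) hkj
          (by rw [sq]; exact hsq') (by omega) (by omega) hkn (fun ε => hacc0 ε p) fun ε =>
            rejected_imp he σ hj1 hjk hkn ε (hL ε) (hsort ε) (by omega)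
        linarith
    have habel := sum_mul_le_sum_mul_of_partial_sums
      (fun i => weight_antitone (e := e) he hval (Nat.le_succ i)) hw0 hpartial
    rw [← Finset.sum_mul] at habel
    have hsub : ∑ p ∈ Finset.range (2 * k), weight y e val p * 𝔼 ε, acc ε p ≤
        ∑ p ∈ Finset.range (2 * n), weight y e val p * 𝔼 ε, acc ε p :=
      Finset.sum_le_sum_of_subset_of_nonneg
        (Finset.range_subset_range.2 (by omega)) fun p _ _ => mul_nonneg (hw0 p) (hE0 p)
    have htop := expect_topSum_le he hval hk hkn
    linarith
  · have hn : 1 ≤ n := by omega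
    have h14 := expect_acc_zero_ge e (acc := acc) hn (fun ε => hacc0 ε 0) (by
      intro ε h0 h1
      obtain ⟨a, ha2, h⟩ := ha ε 2 (by omega)
      have hwalk1 : walk e ε 1 = 1 := by simp [walk, h0]
      have hwalk2 : walk e ε 2 = 0 := by simp [walk, Finset.sum_range_succ, h0, h1]
      have hwa : 0 ≤ walk e ε a := by
        interval_cases a
        · simp [walk]
        · rw [hwalk1]; norm_num
        · rw [hwalk2]
      have hj1R : (1 : ℝ) ≤ j := by exact_mod_cast hj1
      have hacc1 : acc ε 1 = 0 := by
        simp only [hacc, indicatorBid, h1]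
        split_ifs <;> simp
      rw [hwalk2, Finset.sum_range_succ, Finset.sum_range_one, hacc1] at h
      have : (1 : ℝ) ≤ min (((2 : ℕ) - 0 : ℝ) / 2) j := le_min (by norm_num) hj1R
      linarith)
    have hfirst : weight y e val 0 * 𝔼 ε, acc ε 0 ≤
        ∑ p ∈ Finset.range (2 * n), weight y e val p * 𝔼 ε, acc ε p :=
      Finset.single_le_sum (f := fun p => weight y e val p * 𝔼 ε, acc ε p)
        (fun p _ => mul_nonneg (hw0 p) (hE0 p)) (Finset.mem_range.2 (by omega))
    have htop : 𝔼 ε : Fin n → Bool, (topSum k (fun b => val (y (b, ε b))) : ℝ) ≤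
        k * weight y e val 0 := by
      refine (Finset.expect_le_expect fun ε _ =>
        topSum_le_mul_weight_zero (e := e) he hval k ε).trans ?_
      rw [Fintype.expect_const]
    have h1 := mul_le_mul_of_nonneg_left h14 (hw0 0)
    have hkR : (0 : ℝ) ≤ k := Nat.cast_nonneg k
    have h2 := mul_le_mul_of_nonneg_left (h1.trans hfirst) hkR
    linarith

end Positions

/-! ### Welfare bounds for single runs -/

theorem sum_ite_exists_mem_eq {γ δ : Type*} [Fintype δ] (g : γ → δ) (f : δ → ℝ≥0)
    {l : List γ} (hl : (l.map g).Nodup) [DecidablePred fun x => ∃ q ∈ l, g q = x] :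
    ∑ x, (if ∃ q ∈ l, g q = x then f x else 0) = (l.map fun q => f (g q)).sum := by
  classical
  have h := List.sum_toFinset f hl
  rw [List.map_map] at h
  rw [← Finset.sum_filter]
  refine Eq.trans ?_ h
  congr 1
  ext x
  simp

open Classical in
theorem socialWelfare_eq (smp bids v : Profile n m) (σ : Equiv.Perm (Fin n)) (c : Tickets n)
    (π : Equiv.Perm (Fin m)) :
    socialWelfare v ((reserveRehearsal n m).outcome smp bids σ c π).alloc =
      ((trades smp bids σ c π).map fun q => v.1 q.buyer).sum +
        ∑ s, if ∀ q ∈ trades smp bids σ c π, q.seller ≠ s then v.2 s else 0 := by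
  rw [socialWelfare]
  congr 1
  · refine Eq.trans ?_ (sum_ite_exists_mem_eq Proposal.buyer v.1
      (nodup_buyer_trades smp bids σ c π))
    exact Finset.sum_congr rfl fun b _ => if_congr (wins_iff smp bids σ c π b) rfl rfl
  · exact Finset.sum_congr rfl fun s _ => if_congr (alloc_eq_none_iff smp bids σ c π s) rfl rfl

/-- A trade never decreases welfare. -/
theorem sum_sellers_le_socialWelfare (smp v : Profile n m) (σ : Equiv.Perm (Fin n))
    (c : Tickets n) (π : Equiv.Perm (Fin m)) :
    ∑ s, v.2 s ≤ socialWelfare v ((reserveRehearsal n m).outcome smp v σ c π).alloc := by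
  classical
  have h1 : ∑ s, v.2 s = (∑ s, if ∃ q ∈ trades smp v σ c π, q.seller = s then v.2 s else 0) +
      ∑ s, if ∀ q ∈ trades smp v σ c π, q.seller ≠ s then v.2 s else 0 := by
    rw [← Finset.sum_add_distrib]
    refine Finset.sum_congr rfl fun s _ => ?_
    by_cases h : ∃ q ∈ trades smp v σ c π, q.seller = s
    · rw [if_pos h, if_neg (by push Not; exact h), add_zero]
    · rw [if_neg h, if_pos (by push Not at h; exact h), zero_add]
  rw [socialWelfare_eq, h1, sum_ite_exists_mem_eq Proposal.seller v.2 (nodup_seller_trades smp v σ c π)]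
  gcongr
  refine List.sum_le_sum fun q hq => ?_
  have := (mem_trades smp v σ c π).1 hq
  exact this.2.2.trans this.2.1

/-- The welfare that a proposal leads to: the buyer's value if it is agreed to, and the seller's
value otherwise. -/
noncomputable def proposalWelfare (v : Profile n m) (q : Proposal n m) : ℝ≥0 :=
  if Agreed v q then v.1 q.buyer else v.2 q.seller

theorem sum_proposalWelfare_le_socialWelfare (smp v : Profile n m) (σ : Equiv.Perm (Fin n))
    (c : Tickets n) (π : Equiv.Perm (Fin m)) :
    ((allProposals smp v σ c π).map (proposalWelfare v)).sum ≤
      socialWelfare v ((reserveRehearsal n m).outcome smp v σ c π).alloc := by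
  classical
  set Q := allProposals smp v σ c π with hQ
  have hsplit : ∀ l : List (Proposal n m), (l.map (proposalWelfare v)).sum =
      ((l.filter fun q => decide (Agreed v q)).map fun q => v.1 q.buyer).sum +
        ((l.filter fun q => decide ¬Agreed v q).map fun q => v.2 q.seller).sum := by
    intro l
    induction l with
    | nil => simp
    | cons q l ih =>
      by_cases h : Agreed v q
      · rw [List.map_cons, List.sum_cons, ih, List.filter_cons_of_pos (by rwa [decide_eq_true_eq]),
          List.filter_cons_of_neg (by rw [decide_eq_true_eq]; exact not_not.2 h), List.map_cons,
          List.sum_cons, proposalWelfare, if_pos h, add_assoc]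
      · rw [List.map_cons, List.sum_cons, ih, List.filter_cons_of_neg (by rwa [decide_eq_true_eq]),
          List.filter_cons_of_pos (by rwa [decide_eq_true_eq]), List.map_cons, List.sum_cons,
          proposalWelfare, if_neg h]
        ring
  have hnd := nodup_seller_allProposals smp v σ c π
  rw [hsplit, socialWelfare_eq, trades_eq, ← hQ, ← sum_ite_exists_mem_eq Proposal.seller
    v.2 ((List.filter_sublist.map _).nodup hnd)]
  gcongr with s
  split_ifs with h1 h2
  · exact le_rfl
  · exfalso
    obtain ⟨q, hq, hs⟩ := h1
    apply h2
    intro q' hq' hs'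
    rw [List.mem_filter] at hq hq'
    have heq := List.inj_on_of_nodup_map hnd hq.1 hq'.1 (hs.trans hs'.symm)
    subst heq
    have h3 := hq.2
    have h4 := hq'.2
    simp only [decide_eq_true_eq] at h3 h4
    exact h3 h4
  · exact zero_le
  · exact le_rfl

/-- The value of a seller and the sample for her play symmetric roles: in one of the two
assignments the proposal is agreed to, or the seller's value exceeds the buyer's value `x`. -/
theorem le_add_of_exchange {x p s s' : ℝ≥0} (hp : p ≤ x) :
    x ≤ (if max s' p ≤ x ∧ s ≤ max s' p then x else s) +
      (if max s p ≤ x ∧ s' ≤ max s p then x else s') := by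
  split_ifs with h1 h2 h2
  · exact le_self_add
  · exact le_self_add
  · exact le_add_self
  · rcases le_total s s' with h | h
    · have : ¬max s' p ≤ x := fun h' => h1 ⟨h', h.trans (le_max_left _ _)⟩
      rw [max_le_iff, not_and_or] at this
      exact (not_le.1 (this.resolve_right (not_not.2 hp))).le.trans le_add_self
    · have : ¬max s p ≤ x := fun h' => h2 ⟨h', h.trans (le_max_left _ _)⟩
      rw [max_le_iff, not_and_or] at this
      exact (not_le.1 (this.resolve_right (not_not.2 hp))).le.trans le_self_add

theorem sum_le_sum_zipWith_add {γ δ ε : Type*} (h : γ → ℝ≥0) (f f' : γ → δ → ε)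
    (g g' : ε → ℝ≥0) (R : List γ) (ss : List δ) (hlen : R.length ≤ ss.length)
    (H : ∀ x ∈ R, ∀ s, h x ≤ g (f x s) + g' (f' x s)) :
    (R.map h).sum ≤ ((List.zipWith f R ss).map g).sum + ((List.zipWith f' R ss).map g').sum := by
  induction R generalizing ss with
  | nil => simp
  | cons x R ih =>
    cases ss with
    | nil => simp at hlen
    | cons s ss =>
      simp only [List.length_cons, Nat.add_le_add_iff_right] at hlen
      simp only [List.map_cons, List.sum_cons, List.zipWith_cons_cons]
      refine (add_le_add (H x (by simp) s)
        (ih ss hlen fun y hy => H y (by simp [hy]))).trans (le_of_eq ?_)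
      ring

/-- All buyers and the tickets being fixed, the welfare with the sellers' values `vS` and samples
`sS` and the welfare with both exchanged add up to at least the value of the approached buyers. -/
theorem sum_approached_le (vB sB : Fin n → ℝ≥0) (vS sS : Fin m → ℝ≥0) (σ : Equiv.Perm (Fin n))
    (c : Tickets n) (π : Equiv.Perm (Fin m)) :
    ((rehearse (Below fun b => toLex (vB b, c (Sum.inl b))) (List.ofFn σ)
        (thresholds (min n m) c sB)).map fun x => vB x.1).sum ≤
      socialWelfare (vB, vS) ((reserveRehearsal n m).outcome (sB, sS) (vB, vS) σ c π).alloc +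
      socialWelfare (vB, sS) ((reserveRehearsal n m).outcome (sB, vS) (vB, sS) σ c π).alloc := by
  refine le_trans ?_ (add_le_add
    (sum_proposalWelfare_le_socialWelfare (sB, sS) (vB, vS) σ c π)
    (sum_proposalWelfare_le_socialWelfare (sB, vS) (vB, sS) σ c π))
  rw [allProposals, allProposals, proposals_eq, proposals_eq]
  refine sum_le_sum_zipWith_add _ _ _ _ _ _ _ ?_ ?_
  · have h1 := length_rehearse_add_leftover (Below fun b => toLex (vB b, c (Sum.inl b)))
      (List.ofFn σ) (thresholds (min n m) c sB)
    have h2 : (thresholds (min n m) c sB).length ≤ min n m :=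
      (List.length_filterMap_le _ _).trans (by simp)
    rw [List.length_ofFn]
    omega
  · intro x hx s
    have hlt : x.2 < toLex (vB x.1, c (Sum.inl x.1)) :=
      (snd_mem_of_mem_rehearse (fun b => (toLex (vB b, c (Sum.inl b)) : Ticketed n)) _ hx).2
    exact le_add_of_exchange (Prod.Lex.monotone_fst _ _ hlt.le)

/-- Items are sold to at most `min n m` buyers. -/
theorem optWelfare_le (v : Profile n m) :
    optWelfare v ≤ ∑ s, v.2 s + topSum (min n m) v.1 := by
  classical
  refine Finset.sup_le fun a _ => ?_
  rw [socialWelfare, add_comm]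
  refine add_le_add (Finset.sum_le_sum fun s _ => ?_) ?_
  · split_ifs
    · exact le_rfl
    · exact zero_le
  · rw [← Finset.sum_filter]
    refine sum_le_topSum v.1 (le_min ?_ ?_)
    · exact (Finset.card_le_univ _).trans (by simp)
    · have h : (Finset.univ.filter fun b => a.Wins b).map Function.Embedding.some ⊆
          Finset.univ.image a := by
        intro o ho
        obtain ⟨b, hb, rfl⟩ := Finset.mem_map.1 ho
        obtain ⟨s, hs⟩ := (Finset.mem_filter.1 hb).2
        exact Finset.mem_image.2 ⟨s, Finset.mem_univ s, hs⟩
      have := Finset.card_le_card h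
      rw [Finset.card_map] at this
      refine this.trans (Finset.card_image_le.trans (by simp))

/-! ### Measurability -/

theorem capped_map {γ δ : Type*} (f : γ → δ) (k j : ℕ) (L : List γ) :
    capped k j (L.map f) = (capped k j L).map f := by
  rw [capped, capped, List.map_filterMap]
  congr 1
  funext i
  simp

/-- The allocation as a function of finitely many comparisons of numbers: `lt i b` compares the
sample of `i` with the bid of `b`, `le i i'` compares two samples, and `agr b i s` says whether `b`
and `s` agree to trade when the minimal threshold is the sample of `i`. -/
def allocOfComparisons (σ : Equiv.Perm (Fin n)) (π : Equiv.Perm (Fin m))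
    (w : (Fin n → Fin n → Bool) × (Fin n → Fin n → Bool) × (Fin n → Fin n → Fin m → Bool)) :
    Allocation n m := fun s =>
  (((List.zipWith (fun x s => (x, s)) (rehearse w.1 (List.ofFn σ)
      (capped (min n m) (numTop (min n m)) ((List.finRange n).mergeSort w.2.1)))
    (List.ofFn π)).filter fun x => w.2.2 x.1.1 x.1.2 x.2).find? fun x => decide (x.2 = s)).map
      fun x => x.1.1

/-- The comparisons that the mechanism makes for the valuations `z.1` and the samples `z.2`. -/
noncomputable def comparisons (c : Tickets n) (z : Profile n m × Profile n m) :
    (Fin n → Fin n → Bool) × (Fin n → Fin n → Bool) × (Fin n → Fin n → Fin m → Bool) :=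
  (fun i b => decide ((toLex (z.2.1 i, c (Sum.inr i)) : Ticketed n) <
      toLex (z.1.1 b, c (Sum.inl b))),
    fun i i' => decide ((toLex (z.2.1 i', c (Sum.inr i')) : Ticketed n) ≤
      toLex (z.2.1 i, c (Sum.inr i))),
    fun b i s => decide (max (z.2.2 s) (z.2.1 i) ≤ z.1.1 b ∧ z.1.2 s ≤ max (z.2.2 s) (z.2.1 i)))

theorem alloc_eq_allocOfComparisons (z : Profile n m × Profile n m) (σ : Equiv.Perm (Fin n))
    (c : Tickets n) (π : Equiv.Perm (Fin m)) :
    ((reserveRehearsal n m).outcome z.2 z.1 σ c π).alloc =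
      allocOfComparisons σ π (comparisons c z) := by
  set key : Fin n → Ticketed n := fun i => toLex (z.2.1 i, c (Sum.inr i)) with hkey
  have hsort : sortedSamples c z.2.1 =
      ((List.finRange n).mergeSort (comparisons c z).2.1).map key := by
    have := List.map_mergeSort (r := (comparisons c z).2.1)
      (s := fun x y : Ticketed n => decide (y ≤ x)) (f := key) (l := List.finRange n)
      fun a _ b _ => rfl
    rw [this, sortedSamples, List.ofFn_eq_map]
  have hthr : thresholds (min n m) c z.2.1 =
      (capped (min n m) (numTop (min n m))
        ((List.finRange n).mergeSort (comparisons c z).2.1)).map key := by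
    rw [← capped_map, ← hsort]
    rfl
  have htr : trades z.2 z.1 σ c π = ((List.zipWith (fun x s => (x, s))
      (rehearse (comparisons c z).1 (List.ofFn σ)
        (capped (min n m) (numTop (min n m))
          ((List.finRange n).mergeSort (comparisons c z).2.1)))
      (List.ofFn π)).filter fun x => (comparisons c z).2.2 x.1.1 x.1.2 x.2).map
        fun x => propose z.2.2 (x.1.1, key x.1.2) x.2 := by
    rw [trades_eq, allProposals, proposals_eq, hthr, rehearse_map]
    set R := rehearse (fun i b => Below (ticketedBid z.1 c) (key i) b) (List.ofFn σ)
      (capped (min n m) (numTop (min n m))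
        ((List.finRange n).mergeSort (comparisons c z).2.1)) with hR
    have hzip : List.zipWith (propose z.2.2) (R.map (Prod.map id key)) (List.ofFn π) =
        (List.zipWith (fun x s => (x, s)) R (List.ofFn π)).map
          fun x => propose z.2.2 (x.1.1, key x.1.2) x.2 := by
      rw [List.map_zipWith, List.zipWith_map_left]
      rfl
    rw [hzip, List.filter_map]
    rfl
  funext s
  rw [alloc_eq, htr, List.find?_map, Option.map_map]
  rfl

theorem measurable_comparisons (c : Tickets n) :
    Measurable (comparisons c : Profile n m × Profile n m → _) := by
  have hlex : ∀ (f g : Profile n m × Profile n m → ℝ≥0) (t t' : Fin (n + n)), Measurable f →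
      Measurable g → MeasurableSet {z | (toLex (f z, t) : Ticketed n) < toLex (g z, t')} := by
    intro f g t t' hf hg
    simp only [Prod.Lex.toLex_lt_toLex]
    exact (measurableSet_lt hf hg).union ((measurableSet_eq_fun hf hg).inter (.const _))
  refine Measurable.prodMk ?_ (Measurable.prodMk ?_ ?_)
  · refine measurable_pi_iff.2 fun i => measurable_pi_iff.2 fun b => measurable_to_bool ?_
    have := hlex (fun z => z.2.1 i) (fun z => z.1.1 b) (c (Sum.inr i)) (c (Sum.inl b))
      (by fun_prop) (by fun_prop)
    convert this using 1
    ext z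
    simp
  · refine measurable_pi_iff.2 fun i => measurable_pi_iff.2 fun i' => measurable_to_bool ?_
    have := (hlex (fun z => z.2.1 i) (fun z => z.2.1 i') (c (Sum.inr i)) (c (Sum.inr i'))
      (by fun_prop) (by fun_prop)).compl
    convert this using 1
    ext z
    simp only [Set.mem_preimage, Set.mem_singleton_iff, decide_eq_true_eq, Set.mem_compl_iff,
      Set.mem_ofPred_eq, not_lt]
  · refine measurable_pi_iff.2 fun b => measurable_pi_iff.2 fun i => measurable_pi_iff.2 fun s =>
      measurable_to_bool ?_
    have h1 : MeasurableSet {z : Profile n m × Profile n m |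
        max (z.2.2 s) (z.2.1 i) ≤ z.1.1 b} := measurableSet_le (by fun_prop) (by fun_prop)
    have h2 : MeasurableSet {z : Profile n m × Profile n m |
        z.1.2 s ≤ max (z.2.2 s) (z.2.1 i)} := measurableSet_le (by fun_prop) (by fun_prop)
    convert h1.inter h2 using 1
    ext z
    simp

theorem measurable_socialWelfare (a : Allocation n m) :
    Measurable fun v : Profile n m => socialWelfare v a := by
  classical
  unfold socialWelfare
  refine Measurable.add (Finset.measurable_sum _ fun b _ => ?_)
    (Finset.measurable_sum _ fun s _ => ?_)
  · split_ifs <;> fun_prop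
  · split_ifs <;> fun_prop

theorem measurable_socialWelfare_comp {W : Type*} [MeasurableSpace W] [Countable W]
    [MeasurableSingletonClass W] (F : W → Allocation n m) :
    Measurable fun x : Profile n m × W => socialWelfare x.1 (F x.2) :=
  measurable_from_prod_countable_left fun w => measurable_socialWelfare (F w)

theorem measurable_welfare_outcome (σ : Equiv.Perm (Fin n)) (c : Tickets n)
    (π : Equiv.Perm (Fin m)) : Measurable fun z : Profile n m × Profile n m =>
      socialWelfare z.1 ((reserveRehearsal n m).outcome z.2 z.1 σ c π).alloc := by
  have hfun : (fun z : Profile n m × Profile n m =>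
      socialWelfare z.1 ((reserveRehearsal n m).outcome z.2 z.1 σ c π).alloc) =
      (fun x => socialWelfare x.1 (allocOfComparisons σ π x.2)) ∘
        fun z => (z.1, comparisons c z) :=
    funext fun z => congrArg (socialWelfare z.1) (alloc_eq_allocOfComparisons z σ c π)
  rw [hfun]
  have h := measurable_socialWelfare_comp (allocOfComparisons σ π)
  have h2 : Measurable fun z : Profile n m × Profile n m => (z.1, comparisons c z) :=
    measurable_fst.prodMk (measurable_comparisons c)
  exact h.comp h2

theorem measurable_topSum (k : ℕ) : Measurable fun v : Fin n → ℝ≥0 => topSum k v := by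
  have hne : (Finset.univ.filter fun B : Finset (Fin n) => B.card ≤ k).Nonempty :=
    ⟨∅, by simp⟩
  have h := Finset.measurable_sup' hne (f := fun B (v : Fin n → ℝ≥0) => ∑ b ∈ B, v b)
    fun B _ => by fun_prop
  convert h using 1
  funext v
  rw [Finset.sup'_apply, Finset.sup'_eq_sup, topSum]

/-! ### Exchanging values and samples -/

/-- Exchange the values of some agents with the samples for them: those of the buyers chosen by `A`
and, if `τ` is true, those of all sellers. -/
def exchange (A : Fin n → Bool) (τ : Bool) (z : Profile n m × Profile n m) :
    Profile n m × Profile n m :=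
  ((fun b => if A b then z.2.1 b else z.1.1 b, fun s => if τ then z.2.2 s else z.1.2 s),
    (fun b => if A b then z.1.1 b else z.2.1 b, fun s => if τ then z.1.2 s else z.2.2 s))

/-- Permuting coordinates with equal laws preserves a product measure. -/
theorem measurePreserving_comp_perm {ι X : Type*} [Fintype ι] [MeasurableSpace X]
    (μ : ι → Measure X) [∀ i, IsProbabilityMeasure (μ i)] (g : Equiv.Perm ι)
    (hg : ∀ i, μ (g i) = μ i) :
    MeasurePreserving (fun (w : ι → X) i => w (g i)) (Measure.pi μ) (Measure.pi μ) := by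
  have hmeas : Measurable fun (w : ι → X) i => w (g i) := by fun_prop
  refine ⟨hmeas, (Measure.pi_eq fun s hs => ?_).symm⟩
  rw [Measure.map_apply hmeas (.univ_pi hs)]
  have hpre : (fun (w : ι → X) i => w (g i)) ⁻¹' Set.univ.pi s =
      Set.univ.pi fun i => s (g.symm i) := by
    ext w
    simp only [Set.mem_preimage, Set.mem_univ_pi]
    exact ⟨fun h i => by simpa using h (g.symm i), fun h i => by simpa using h (g i)⟩
  rw [hpre, Measure.pi_pi, ← Equiv.prod_comp g]
  simp [hg]

/-- The values and the samples read off from a family indexed by all agents twice. -/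
def splitFamily (w : (Fin n ⊕ Fin m) ⊕ (Fin n ⊕ Fin m) → ℝ≥0) : Profile n m × Profile n m :=
  ((fun b => w (.inl (.inl b)), fun s => w (.inl (.inr s))),
    (fun b => w (.inr (.inl b)), fun s => w (.inr (.inr s))))

variable (FB : Fin n → Measure ℝ≥0) (FS : Fin m → Measure ℝ≥0)
  [∀ b, IsProbabilityMeasure (FB b)] [∀ s, IsProbabilityMeasure (FS s)]

instance isProbabilityMeasure_marketLaw : IsProbabilityMeasure (marketLaw FB FS) := by
  unfold marketLaw
  infer_instance

instance isProbabilityMeasure_sumElim (x : Fin n ⊕ Fin m) :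
    IsProbabilityMeasure (Sum.elim FB FS x) := by
  cases x <;> simp only [Sum.elim_inl, Sum.elim_inr] <;> infer_instance

instance isProbabilityMeasure_sumElim_sumElim (x : (Fin n ⊕ Fin m) ⊕ (Fin n ⊕ Fin m)) :
    IsProbabilityMeasure (Sum.elim (Sum.elim FB FS) (Sum.elim FB FS) x) := by
  cases x <;> simp only [Sum.elim_inl, Sum.elim_inr] <;> infer_instance

theorem measurePreserving_splitFamily : MeasurePreserving splitFamily
    (Measure.pi (Sum.elim (Sum.elim FB FS) (Sum.elim FB FS)))
    ((marketLaw FB FS).prod (marketLaw FB FS)) := by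
  have h1 := measurePreserving_sumPiEquivProdPi (X := fun _ => ℝ≥0)
    (Sum.elim (Sum.elim FB FS) (Sum.elim FB FS))
  have h2 := measurePreserving_sumPiEquivProdPi (X := fun _ => ℝ≥0) (Sum.elim FB FS)
  exact (h2.prod h2).comp h1

/-- The permutation of the coordinates that underlies `exchange`. -/
def exchangePerm (A : Fin n → Bool) (τ : Bool) :
    Equiv.Perm ((Fin n ⊕ Fin m) ⊕ (Fin n ⊕ Fin m)) :=
  Function.Involutive.toPerm
    (Sum.elim (fun i => if Sum.elim A (fun _ => τ) i then .inr i else .inl i)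
      (fun i => if Sum.elim A (fun _ => τ) i then .inl i else .inr i)) (by
      rintro (i | i) <;> by_cases h : Sum.elim A (fun _ => τ) i <;> simp [h])

theorem exchangePerm_inl (A : Fin n → Bool) (τ : Bool) (i : Fin n ⊕ Fin m) :
    exchangePerm A τ (.inl i) = if Sum.elim A (fun _ => τ) i then .inr i else .inl i := rfl

theorem exchangePerm_inr (A : Fin n → Bool) (τ : Bool) (i : Fin n ⊕ Fin m) :
    exchangePerm A τ (.inr i) = if Sum.elim A (fun _ => τ) i then .inl i else .inr i := rfl

/-- Values and samples have the same law. -/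
theorem measurePreserving_exchange (A : Fin n → Bool) (τ : Bool) :
    MeasurePreserving (exchange A τ) ((marketLaw FB FS).prod (marketLaw FB FS))
      ((marketLaw FB FS).prod (marketLaw FB FS)) := by
  have h1 := measurePreserving_splitFamily FB FS
  have h2 := measurePreserving_comp_perm (Sum.elim (Sum.elim FB FS) (Sum.elim FB FS))
    (exchangePerm A τ) (by
      rintro (i | i) <;> by_cases h : Sum.elim A (fun _ => τ) i <;>
        simp [exchangePerm_inl, exchangePerm_inr, h])
  have hmeas : Measurable (exchange A τ : Profile n m × Profile n m → _) := by
    unfold exchange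
    refine Measurable.prodMk (Measurable.prodMk ?_ ?_) (Measurable.prodMk ?_ ?_) <;>
      refine measurable_pi_iff.2 fun i => ?_ <;> split_ifs <;> fun_prop
  have hcomm : exchange A τ ∘ splitFamily =
      splitFamily ∘ fun (w : (Fin n ⊕ Fin m) ⊕ (Fin n ⊕ Fin m) → ℝ≥0) i =>
        w (exchangePerm A τ i) := by
    funext w
    simp only [Function.comp, exchange, splitFamily, exchangePerm_inl, exchangePerm_inr,
      Sum.elim_inl, Sum.elim_inr]
    refine Prod.ext (Prod.ext ?_ ?_) (Prod.ext ?_ ?_) <;> funext i <;> simp only <;>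
      exact (apply_ite w _ _ _).symm
  refine ⟨hmeas, ?_⟩
  have h3 := (h1.comp h2).map_eq
  rw [← hcomm, ← Measure.map_map hmeas h1.measurable, h1.map_eq] at h3
  exact h3

/-- Exchange the tickets along with the numbers. -/
def exchangeTickets (A : Fin n → Bool) : Equiv.Perm (Fin n ⊕ Fin n) :=
  Function.Involutive.toPerm
    (Sum.elim (fun b => if A b then .inr b else .inl b)
      (fun b => if A b then .inl b else .inr b)) (by
      rintro (b | b) <;> by_cases h : A b <;> simp [h])

theorem exchangeTickets_inl (A : Fin n → Bool) (b : Fin n) :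
    exchangeTickets A (.inl b) = if A b then .inr b else .inl b := rfl

theorem exchangeTickets_inr (A : Fin n → Bool) (b : Fin n) :
    exchangeTickets A (.inr b) = if A b then .inl b else .inr b := rfl

/-- The two ticketed numbers of each buyer: her bid and her sample. -/
noncomputable def ticketedNumbers (z : Profile n m × Profile n m) (c : Tickets n)
    (x : Fin n × Bool) : Ticketed n :=
  if x.2 then toLex (z.2.1 x.1, c (.inr x.1)) else toLex (z.1.1 x.1, c (.inl x.1))

theorem ticketedNumbers_injective (z : Profile n m × Profile n m) (c : Tickets n) :
    Function.Injective (ticketedNumbers z c) := by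
  rintro ⟨b, x⟩ ⟨b', x'⟩ h
  have h2 : (ofLex (ticketedNumbers z c (b, x))).2 = (ofLex (ticketedNumbers z c (b', x'))).2 := by
    rw [h]
  cases x <;> cases x' <;> simp [ticketedNumbers] at h2 <;> simp [h2]

theorem toLex_exchange_bid (z : Profile n m × Profile n m) (c : Tickets n) (A : Fin n → Bool)
    (τ : Bool) (b : Fin n) :
    (toLex ((exchange A τ z).1.1 b, ((exchangeTickets A).trans c) (.inl b)) : Ticketed n) =
      ticketedNumbers z c (b, A b) := by
  by_cases h : A b <;> simp [exchange, exchangeTickets_inl, ticketedNumbers, h]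

theorem toLex_exchange_sample (z : Profile n m × Profile n m) (c : Tickets n) (A : Fin n → Bool)
    (τ : Bool) (b : Fin n) :
    (toLex ((exchange A τ z).2.1 b, ((exchangeTickets A).trans c) (.inr b)) : Ticketed n) =
      ticketedNumbers z c (b, !A b) := by
  by_cases h : A b <;> simp [exchange, exchangeTickets_inr, ticketedNumbers, h]

/-! ### The approximation ratio -/

/-- The expected welfare over the randomness of the mechanism, for the values `z.1` and the samples
`z.2`. -/
noncomputable def runWelfare (σ : Equiv.Perm (Fin n)) (z : Profile n m × Profile n m) : ℝ≥0 :=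
  𝔼 x : Tickets n × Equiv.Perm (Fin m),
    socialWelfare z.1 ((reserveRehearsal n m).outcome z.2 z.1 σ x.1 x.2).alloc

theorem runWelfare_reindex (σ : Equiv.Perm (Fin n)) (A : Fin n → Bool)
    (z : Profile n m × Profile n m) :
    runWelfare σ z = 𝔼 x : Tickets n × Equiv.Perm (Fin m), socialWelfare z.1
      ((reserveRehearsal n m).outcome z.2 z.1 σ ((exchangeTickets A).trans x.1) x.2).alloc := by
  rw [runWelfare]
  let r : Tickets n ≃ Tickets n :=
    { toFun := fun c => (exchangeTickets A).trans c
      invFun := fun c => (exchangeTickets A).symm.trans c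
      left_inv := fun c => by ext; simp
      right_inv := fun c => by ext; simp }
  exact (Fintype.expect_equiv (r.prodCongr (Equiv.refl _)) _ _ fun _ => rfl).symm

/-- The guarantee of the buyers' side, against the best `k` buyers. -/
noncomputable def rehearsalRatio (k : ℕ) : ℝ := if largeK ≤ k then 50 / 27 else 4 * k

theorem rehearsalRatio_nonneg (k : ℕ) : 0 ≤ rehearsalRatio k := by
  rw [rehearsalRatio]
  split_ifs <;> positivity

/-- The welfare guarantee, averaged over all exchanges of bids and samples of buyers. The tickets
are exchanged along with the numbers, so that for fixed tickets the same `2 * n` ticketed numbers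
occur throughout. -/
theorem expect_topSum_exchange_le (σ : Equiv.Perm (Fin n)) (z : Profile n m × Profile n m)
    (h : 0 < min n m) :
    𝔼 A : Fin n → Bool, (topSum (min n m) (exchange A false z).1.1 : ℝ) ≤
      rehearsalRatio (min n m) * 𝔼 A : Fin n → Bool,
        ((runWelfare σ (exchange A false z) : ℝ) + runWelfare σ (exchange A true z)) := by
  set k := min n m with hk
  -- For fixed tickets and seller order, sum over the two roles of the sellers.
  have hrun : ∀ (c : Tickets n) (π : Equiv.Perm (Fin m)),
      𝔼 A : Fin n → Bool, (topSum k (exchange A false z).1.1 : ℝ) ≤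
      rehearsalRatio k * 𝔼 A : Fin n → Bool,
        ((socialWelfare (exchange A false z).1 ((reserveRehearsal n m).outcome
            (exchange A false z).2 (exchange A false z).1 σ
              ((exchangeTickets A).trans c) π).alloc : ℝ) +
          socialWelfare (exchange A true z).1 ((reserveRehearsal n m).outcome
            (exchange A true z).2 (exchange A true z).1 σ
              ((exchangeTickets A).trans c) π).alloc) := by
    intro c π
    set y := ticketedNumbers z c with hy
    set L : (Fin n → Bool) → List (Ticketed n) := fun A =>
      sortedSamples ((exchangeTickets A).trans c) (exchange A false z).2.1 with hL
    have hofFn : ∀ A, (List.ofFn fun b =>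
        (toLex ((exchange A false z).2.1 b, ((exchangeTickets A).trans c) (.inr b)) : Ticketed n)) =
        List.ofFn fun b => y (b, !A b) := fun A =>
      congrArg _ (funext fun b => toLex_exchange_sample z c A false b)
    have hperm : ∀ A, (L A).Perm (List.ofFn fun b => y (b, !A b)) := by
      intro A
      rw [← hofFn A]
      exact List.mergeSort_perm _ _
    have hsort : ∀ A, (L A).Pairwise (· ≥ ·) := by
      intro A
      have := List.pairwise_mergeSort (le := fun x y : Ticketed n => decide (y ≤ x))
        (fun a b c hab hbc => by
          rw [decide_eq_true_eq] at hab hbc ⊢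
          exact hbc.trans hab)
        (fun a b => by
          rw [Bool.or_eq_true, decide_eq_true_eq, decide_eq_true_eq]
          exact le_total b a)
        (List.ofFn fun b => (toLex ((exchange A false z).2.1 b,
          ((exchangeTickets A).trans c) (.inr b)) : Ticketed n))
      exact this.imp fun h => of_decide_eq_true h
    have hval : Monotone fun x : Ticketed n => (ofLex x).1 := Prod.Lex.monotone_fst
    have hmain := expect_topSum_le_mul (L := L) (ticketedNumbers_injective z c) hval σ h
      (min_le_left n m) hperm hsort
    have hvalue : ∀ A b, (ofLex (y (b, A b))).1 = (exchange A false z).1.1 b := fun A b => by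
      rw [hy, ← toLex_exchange_bid z c A false b]
      rfl
    have htop : ∀ A, topSum k (fun b => (ofLex (y (b, A b))).1) =
        topSum k (exchange A false z).1.1 := fun A =>
      congrArg _ (funext fun b => hvalue A b)
    simp only [← hy, htop] at hmain
    refine hmain.trans (mul_le_mul_of_nonneg_left (Finset.expect_le_expect fun A _ => ?_)
      (rehearsalRatio_nonneg k))
    have hle := sum_approached_le (exchange A false z).1.1 (exchange A false z).2.1 z.1.2 z.2.2 σ
      ((exchangeTickets A).trans c) π
    have hnd : ((rehearse (Exceeds fun b => y (b, A b)) (List.ofFn σ)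
        (capped k (numTop k) (L A))).map Prod.fst).Nodup :=
      (map_fst_rehearse_sublist _ _ _).nodup (nodup_ofFn_perm σ)
    have hbid : (fun b => (toLex ((exchange A false z).1.1 b,
        ((exchangeTickets A).trans c) (.inl b)) : Ticketed n)) = fun b => y (b, A b) :=
      funext fun b => toLex_exchange_bid z c A false b
    have hsum : ∑ b ∈ approachedSet y σ (capped k (numTop k) (L A)) A,
        ((ofLex (y (b, A b))).1 : ℝ≥0) = ((rehearse (Below fun b =>
          (toLex ((exchange A false z).1.1 b, ((exchangeTickets A).trans c) (.inl b)) : Ticketed n))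
            (List.ofFn σ) (thresholds k ((exchangeTickets A).trans c)
              (exchange A false z).2.1)).map fun x => (exchange A false z).1.1 x.1).sum := by
      rw [hbid, approachedSet, List.sum_toFinset _ hnd, List.map_map]
      refine congrArg List.sum (List.map_congr_left fun x _ => hvalue A x.1)
    refine le_trans (le_of_eq ?_) (NNReal.coe_le_coe.2 hle)
    rw [← hsum]
    push_cast
    rfl
  have hreal : ∀ A τ, (runWelfare σ (exchange A τ z) : ℝ) =
      𝔼 x : Tickets n × Equiv.Perm (Fin m), (socialWelfare (exchange A τ z).1
        ((reserveRehearsal n m).outcome (exchange A τ z).2 (exchange A τ z).1 σ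
          ((exchangeTickets A).trans x.1) x.2).alloc : ℝ) := by
    intro A τ
    rw [runWelfare_reindex σ A, NNReal.coe_expect]
  simp only [hreal, ← Finset.expect_add_distrib]
  rw [Finset.expect_comm, Finset.mul_expect]
  have : Nonempty (Tickets n) := ⟨finSumFinEquiv⟩
  exact Finset.le_expect Finset.univ_nonempty fun x _ => hrun x.1 x.2

theorem measurable_runWelfare (σ : Equiv.Perm (Fin n)) :
    Measurable (runWelfare σ : Profile n m × Profile n m → ℝ≥0) := by
  unfold runWelfare
  simp only [Fintype.expect_eq_sum_div_card]
  refine Measurable.div_const ?_ _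
  exact Finset.measurable_sum _ fun x _ => measurable_welfare_outcome σ x.1 x.2

/-- The expected value of the best `k` buyers is bounded by the expected welfare. -/
theorem lintegral_topSum_le (σ : Equiv.Perm (Fin n)) (h : 0 < min n m) :
    ∫⁻ z, (topSum (min n m) z.1.1 : ℝ≥0∞) ∂((marketLaw FB FS).prod (marketLaw FB FS)) ≤
      ENNReal.ofReal (2 * rehearsalRatio (min n m)) *
        ∫⁻ z, (runWelfare σ z : ℝ≥0∞) ∂((marketLaw FB FS).prod (marketLaw FB FS)) := by
  set k := min n m with hk
  set ν := (marketLaw FB FS).prod (marketLaw FB FS) with hν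
  set R : ℝ≥0 := (rehearsalRatio k).toNNReal with hR
  have hRcoe : (R : ℝ) = rehearsalRatio k := Real.coe_toNNReal _ (rehearsalRatio_nonneg k)
  have hmT : Measurable fun z : Profile n m × Profile n m => (topSum k z.1.1 : ℝ≥0∞) :=
    ((measurable_topSum k).comp (measurable_fst.comp measurable_fst)).coe_nnreal_ennreal
  have hmW : Measurable fun z : Profile n m × Profile n m => (runWelfare σ z : ℝ≥0∞) :=
    (measurable_runWelfare σ).coe_nnreal_ennreal
  have hT : ∀ A τ, ∫⁻ z, (topSum k (exchange A τ z).1.1 : ℝ≥0∞) ∂ν =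
      ∫⁻ z, (topSum k z.1.1 : ℝ≥0∞) ∂ν := fun A τ =>
    (measurePreserving_exchange FB FS A τ).lintegral_comp hmT
  have hW : ∀ A τ, ∫⁻ z, (runWelfare σ (exchange A τ z) : ℝ≥0∞) ∂ν =
      ∫⁻ z, (runWelfare σ z : ℝ≥0∞) ∂ν := fun A τ =>
    (measurePreserving_exchange FB FS A τ).lintegral_comp hmW
  have hpoint : ∀ z : Profile n m × Profile n m,
      ∑ A : Fin n → Bool, (topSum k (exchange A false z).1.1 : ℝ≥0∞) ≤
        R * ∑ A : Fin n → Bool, ((runWelfare σ (exchange A false z) : ℝ≥0∞) +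
          runWelfare σ (exchange A true z)) := by
    intro z
    have hz := expect_topSum_exchange_le σ z h
    rw [Fintype.expect_eq_sum_div_card, Fintype.expect_eq_sum_div_card, ← mul_div_assoc] at hz
    have hcard : (0 : ℝ) < Fintype.card (Fin n → Bool) := by exact_mod_cast Fintype.card_pos
    rw [div_le_div_iff_of_pos_right hcard, ← hk, ← hRcoe] at hz
    exact_mod_cast hz
  have hint := lintegral_mono (μ := ν) hpoint
  have hmeasE : ∀ A τ, Measurable (exchange A τ : Profile n m × Profile n m → _) := fun A τ =>
    (measurePreserving_exchange FB FS A τ).measurable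
  have hmT' : ∀ A, Measurable fun z => (topSum k (exchange A false z).1.1 : ℝ≥0∞) := fun A =>
    hmT.comp (hmeasE A false)
  have hmW' : ∀ A τ, Measurable fun z => (runWelfare σ (exchange A τ z) : ℝ≥0∞) := fun A τ =>
    hmW.comp (hmeasE A τ)
  have hmadd : ∀ A, Measurable fun z => (runWelfare σ (exchange A false z) : ℝ≥0∞) +
      runWelfare σ (exchange A true z) := fun A => (hmW' A false).add (hmW' A true)
  rw [lintegral_finsetSum _ fun A _ => hmT' A, lintegral_const_mul _
    (Finset.measurable_sum _ fun A _ => hmadd A), lintegral_finsetSum _ fun A _ => hmadd A] at hint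
  have hadd : ∀ A : Fin n → Bool, ∫⁻ z, ((runWelfare σ (exchange A false z) : ℝ≥0∞) +
      runWelfare σ (exchange A true z)) ∂ν = 2 * ∫⁻ z, (runWelfare σ z : ℝ≥0∞) ∂ν := by
    intro A
    rw [lintegral_add_left (hmW' A false), hW, hW, two_mul]
  simp only [hadd, hT, Finset.sum_const, nsmul_eq_mul] at hint
  have hcard0 : ((Finset.univ : Finset (Fin n → Bool)).card : ℝ≥0∞) ≠ 0 := by
    simp
  have hcardtop : ((Finset.univ : Finset (Fin n → Bool)).card : ℝ≥0∞) ≠ ∞ :=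
    ENNReal.natCast_ne_top _
  rw [mul_left_comm, ENNReal.mul_le_mul_iff_right hcard0 hcardtop] at hint
  refine hint.trans (le_of_eq ?_)
  rw [ENNReal.ofReal_mul (by norm_num), ← mul_assoc, mul_comm (R : ℝ≥0∞)]
  congr 2
  simp

/-- The sellers' part of the optimum is covered by the welfare of every run, the buyers' part on
average. -/
theorem expectedOpt_le (σ : Equiv.Perm (Fin n)) (h : 0 < min n m) :
    expectedOpt FB FS ≤ ENNReal.ofReal (1 + 2 * rehearsalRatio (min n m)) *
      (reserveRehearsal n m).expectedWelfare σ FB FS := by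
  set k := min n m with hk
  set ν := (marketLaw FB FS).prod (marketLaw FB FS) with hν
  have hwelfare : (reserveRehearsal n m).expectedWelfare σ FB FS =
      ∫⁻ z, (runWelfare σ z : ℝ≥0∞) ∂ν := rfl
  have hopt : expectedOpt FB FS ≤
      ∫⁻ z, ((∑ s, z.1.2 s : ℝ≥0) : ℝ≥0∞) + (topSum k z.1.1 : ℝ≥0∞) ∂ν := by
    have hmeas : Measurable fun v : Profile n m =>
        ((∑ s, v.2 s : ℝ≥0) : ℝ≥0∞) + (topSum k v.1 : ℝ≥0∞) :=
      (Measurable.coe_nnreal_ennreal (by fun_prop)).add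
        ((measurable_topSum k).comp measurable_fst).coe_nnreal_ennreal
    have hfst : MeasurePreserving Prod.fst ν (marketLaw FB FS) := measurePreserving_fst
    have h1 := hfst.lintegral_comp hmeas
    rw [h1]
    refine lintegral_mono fun v => ?_
    rw [← ENNReal.coe_add]
    exact ENNReal.coe_le_coe.2 (optWelfare_le v)
  have hmS : Measurable fun z : Profile n m × Profile n m =>
      ((∑ s, z.1.2 s : ℝ≥0) : ℝ≥0∞) := Measurable.coe_nnreal_ennreal (by fun_prop)
  rw [lintegral_add_left hmS] at hopt
  have hsellers : ∫⁻ z, ((∑ s, z.1.2 s : ℝ≥0) : ℝ≥0∞) ∂ν ≤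
      ∫⁻ z, (runWelfare σ z : ℝ≥0∞) ∂ν := by
    refine lintegral_mono fun z => ENNReal.coe_le_coe.2 ?_
    have : Nonempty (Tickets n) := ⟨finSumFinEquiv⟩
    exact Finset.le_expect Finset.univ_nonempty fun x _ =>
      sum_sellers_le_socialWelfare z.2 z.1 σ x.1 x.2
  refine hopt.trans ((add_le_add hsellers (lintegral_topSum_le FB FS σ h)).trans (le_of_eq ?_))
  rw [hwelfare, ENNReal.ofReal_add zero_le_one
    (mul_nonneg zero_le_two (rehearsalRatio_nonneg k)), ENNReal.ofReal_one, add_mul, one_mul]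

/-- For large `k` the left side is `100 / 27 < 2 + √3`; for all smaller `k` the term
`10 ^ 22 / √k` exceeds `8 * k`. -/
theorem two_mul_rehearsalRatio_le {k : ℕ} (hk : 0 < k) :
    2 * rehearsalRatio k ≤ 1 / (2 - √3) * (1 + 10 ^ 22 / √(k : ℝ)) := by
  have h3 : √3 ^ 2 = 3 := Real.sq_sqrt (by norm_num)
  have h3l : 1.73 < √3 := Real.lt_sqrt_of_sq_lt (by norm_num)
  have hconst : 1 / (2 - √3) = 2 + √3 := by
    rw [div_eq_iff (by nlinarith)]
    nlinarith
  have hkR : (0 : ℝ) < k := by exact_mod_cast hk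
  have hsk : 0 < √(k : ℝ) := Real.sqrt_pos.2 hkR
  rw [hconst, rehearsalRatio]
  have hpos : 0 ≤ 10 ^ 22 / √(k : ℝ) := by positivity
  split_ifs with h
  · nlinarith
  · rw [largeK, not_le] at h
    have hk14 : (k : ℝ) ≤ 10 ^ 14 := by exact_mod_cast h.le
    have hsk7 : √(k : ℝ) ≤ 10 ^ 7 := Real.sqrt_le_iff.2 ⟨by norm_num, by linarith⟩
    have hdiv : 10 ^ 15 ≤ 10 ^ 22 / √(k : ℝ) := by
      rw [le_div_iff₀ hsk]
      linarith
    nlinarith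

theorem isApprox {n m : ℕ} (h : 0 < min n m) : (reserveRehearsal n m).IsApprox
    (1 + 1 / (2 - √3) * (1 + 10 ^ 22 / √((min n m : ℕ) : ℝ))) := by
  intro σ FB FS hB hS
  refine (expectedOpt_le FB FS σ h).trans ?_
  refine mul_le_mul_left (ENNReal.ofReal_le_ofReal ?_) _
  linarith [two_mul_rehearsalRatio_le h]

end ReserveRehearsal

theorem mainTheorem6 :
    (∀ n m : ℕ,
      (reserveRehearsal n m).KeepersUnpaid ∧
      (reserveRehearsal n m).IsIR ∧ (reserveRehearsal n m).IsExPostIR ∧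
      (reserveRehearsal n m).IsDSIC ∧
      (reserveRehearsal n m).IsSBB ∧ (reserveRehearsal n m).IsExPostSBB ∧
      (reserveRehearsal n m).IsOnline) ∧
    ∃ C : ℝ, 0 ≤ C ∧ ∀ n m : ℕ, 0 < min n m →
      (reserveRehearsal n m).IsApprox
        (1 + 1 / (2 - √3) * (1 + C / √((min n m : ℕ) : ℝ))) :=
  ⟨fun n m => ⟨ReserveRehearsal.keepersUnpaid n m, ReserveRehearsal.isIR n m,
    ReserveRehearsal.isExPostIR n m, ReserveRehearsal.isDSIC n m, ReserveRehearsal.isSBB n m,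
    ReserveRehearsal.isExPostSBB n m, ReserveRehearsal.isOnline n m⟩,
    10 ^ 22, by norm_num, fun _ _ h => ReserveRehearsal.isApprox h⟩
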